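/- There is a universal constant $C>0$ such that the following holds. Let $N$ be a finite ground set with $n=|N|\ge 2$, let $f:2^N\to\mathbb Z$ be nonnegative, monotone and submodular, and let $L\ge 2$ be an integer with $f(\emptyset)<L\le f(N)$. Let $k^*$ be the minimum of $|S|$ over all $S\subseteq N$ with $f(S)\ge L$. The function $f$ is given by a value oracle; an adaptive round is one batch of oracle queries, none of which depends on the answers to the others. Write $\Delta(T,S)=f(S\cup T)-f(S)$, and let $\mathcal U(A,t)$ be the uniform distribution on the $t$-element subsets of $A$. **Adaptive-Greedy-Cover.** Let $\Delta^*=\max_{x}f(\{x\})$. If $\Delta^*\ge L$, return a singleton of value $\Delta^*$. Otherwise put $\varepsilon=\tfrac12$, $m=\lceil\log(\Delta^*)/\varepsilon\rceil$, $\delta=\frac1{n(m+1)}$ and $S=\emptyset$. For $i=0,\dots,m$, extend $S$ by the subroutine below with threshold $\tau=(1-\varepsilon)^i\Delta^*$, and stop as soon as $f(S)\ge L$. Return $S$. **Threshold-Sampling-For-Cover.** Put $\hat\varepsilon=\varepsilon/3$, $r=\lceil\log_{1/(1-\hat\varepsilon)}(2n/\delta)\rceil$, $\hat m=\lceil\log_{1+\hat\varepsilon}n\rceil$,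 $\hat\delta=\frac{\delta}{2r(\hat m+1)}$ and $A=N$. Repeat at most $r$ times: 1. Replace $A$ by $\{x\in A:\Delta(\{x\},S)\ge\tau\}$; stop if $A=\emptyset$. 2. Let $t_i=\min\{\lfloor(1+\hat\varepsilon)^i\rfloor,|A|\}$ for $0\le i\le\hat m$. For each $i$, take $16\lceil\log(2/\hat\delta)/\hat\varepsilon^2\rceil$ independent samples of the indicator of $\Delta(\{x\},S\cup T)\ge\tau$, where $T\sim\mathcal U(A,t_i-1)$ and $x$ is uniform in $A\setminus T$. Let $t$ be the first $t_i$ whose empirical mean is at most $1-\tfrac32\hat\varepsilon$, or $t_{\hat m}$ if there is none. 3. Draw $T\sim\mathcal U\bigl(A,\min\{t,\lfloor\frac{L-f(S)}{(1-\varepsilon)\tau}\rfloor\}\bigr)$ and replace $S$ by $S\cup T$; stop if $f(S)\ge L$. The samples of step 2 are evaluated in a single adaptive round. **Theorem.** (a) On every outcome, Adaptive-Greedy-Cover uses at most $C\log(n\log L)\log L$ adaptive rounds, with at most $C(n\log L)^2$ oracle queries in each. Its output $S$ satisfies $\Pr[f(S)\ge L]\ge 1-\tfrac1n$ and $\mathbb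 E[|S|]\le C\,k^*\log L$. (b) If the algorithm is completed by a final check that replaces the output by $N$ whenever $f(S)<L$, then $f(S)\ge L$ holds on every outcome, and the same bounds (with the same $C$) hold for the number of adaptive rounds, the queries per round and $\mathbb E[|S|]$. -/

import Mathlib

universe u

/-! ### Set functions -/

section SetFunctions

/-- The marginal gain `Δ(T, S) = f (S ∪ T) - f S`. -/
def marginalGain {α : Type*} [DecidableEq α] (f : Finset α → ℤ) (T S : Finset α) : ℤ :=
  f (S ∪ T) - f S

/-- Submodularity (diminishing returns): `Δ(x, S) ≥ Δ(x, T)` whenever `S ⊆ T` and `x ∉ T`. -/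
def IsSubmodular {α : Type*} [DecidableEq α] (f : Finset α → ℤ) : Prop :=
  ∀ S T : Finset α, S ⊆ T → ∀ x, x ∉ T → marginalGain f {x} T ≤ marginalGain f {x} S

/-- The minimum size of a set `S` with `f S ≥ L` (used only when such a set exists). -/
noncomputable def optCoverSize {α : Type*} (f : Finset α → ℤ) (L : ℤ) : ℕ :=
  sInf {k : ℕ | ∃ S : Finset α, S.card = k ∧ L ≤ f S}

end SetFunctions

/-! ### Randomized algorithms with adaptive access to a value oracle -/

/-- A randomized algorithm on the ground set `α` with access to a value oracle for an unknown
set function. It can stop with a result, draw a sample from a distribution, or spend one adaptive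
round: it submits a finite batch of sets and continues with the answers. The program does not
mention the set function; it sees it only through the answers. -/
inductive AdaptiveAlg (α : Type u) (β : Type u) : Type (u + 1)
  | ret (b : β) : AdaptiveAlg α β
  | draw {ι : Type u} (μ : PMF ι) (k : ι → AdaptiveAlg α β) : AdaptiveAlg α β
  | query (Q : Finset (Finset α)) (k : (Finset α → ℤ) → AdaptiveAlg α β) : AdaptiveAlg α β

namespace AdaptiveAlg

/-- Sequential composition. -/
def bind {α β γ : Type u} : AdaptiveAlg α β → (β → AdaptiveAlg α γ) → AdaptiveAlg α γ
  | ret b, g => g b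
  | draw μ k, g => draw μ fun i => (k i).bind g
  | query Q k, g => query Q fun v => (k v).bind g

/-- Execution with oracle `f`: the joint law of the result and of the list of the batch sizes, one
entry for every adaptive round. Only the values of `f` on the submitted sets are revealed. -/
noncomputable def run {α β : Type u} [DecidableEq α] (f : Finset α → ℤ) :
    AdaptiveAlg α β → PMF (β × List ℕ)
  | ret b => PMF.pure (b, [])
  | draw μ k => μ.bind fun i => run f (k i)
  | query Q k =>
      (run f (k fun S => if S ∈ Q then f S else 0)).map fun o => (o.1, Q.card :: o.2)

/-- On every possible outcome, at most `R` adaptive rounds with at most `q` queries each. -/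
def RunsWithin {α β : Type u} [DecidableEq α] (f : Finset α → ℤ) (a : AdaptiveAlg α β)
    (R q : ℝ) : Prop :=
  ∀ o ∈ (run f a).support, (o.2.length : ℝ) ≤ R ∧ ∀ b ∈ o.2, (b : ℝ) ≤ q

/-- The law of the result. -/
noncomputable def law {α β : Type u} [DecidableEq α] (f : Finset α → ℤ) (a : AdaptiveAlg α β) :
    PMF β :=
  (run f a).map Prod.fst

/-- The probability that the returned set `S` has `f S ≥ L`. -/
noncomputable def coverProb {α : Type u} [Fintype α] [DecidableEq α] (f : Finset α → ℤ)
    (a : AdaptiveAlg α (Finset α)) (L : ℤ) : ℝ :=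
  ∑ S : Finset α, if L ≤ f S then (law f a S).toReal else 0

/-- The expected size of the returned set. -/
noncomputable def expectedSize {α : Type u} [Fintype α] [DecidableEq α] (f : Finset α → ℤ)
    (a : AdaptiveAlg α (Finset α)) : ℝ :=
  ∑ S : Finset α, (law f a S).toReal * (S.card : ℝ)

end AdaptiveAlg

/-! ### The algorithm -/

namespace SubmodularCover

/-- `U(A, t)`: the uniform distribution over the subsets of `A` of size `t`
(the algorithm uses it only for `t ≤ |A|`). -/
noncomputable def uniformSubset {α : Type u} (A : Finset α) (t : ℕ) : PMF (Finset α) :=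
  if h : (A.powersetCard t).Nonempty then PMF.uniformOfFinset _ h else PMF.pure ∅

/-- Independent draws from the distributions in a list. -/
noncomputable def independentDraws {β : Type u} : List (PMF β) → PMF (List β)
  | [] => PMF.pure []
  | μ :: l => μ.bind fun b => (independentDraws l).map fun bs => b :: bs

/-- The sample behind one draw from `D_t`: `T ∼ U(A, t - 1)`, then an element `x` of `A \ T`
uniformly at random; it is stored as the pair `(T, {x})`. -/
noncomputable def sampleD {α : Type u} [DecidableEq α] (A : Finset α) (t : ℕ) :
    PMF (Finset α × Finset α) :=
  (uniformSubset A (t - 1)).bind fun T => (uniformSubset (A \ T) 1).map fun X => (T, X)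

/-- The number of samples used by `reducedMean` with error `ε` and failure probability `δ`. -/
noncomputable def numSamples (ε δ : ℝ) : ℕ := 16 * ⌈Real.log (2 / δ) / ε ^ 2⌉₊

/-- The test of Reduced-Mean on a list of samples: is the empirical mean at most `1 - 1.5 ε`? -/
def reducedMean (ε : ℝ) (b : List Bool) : Prop :=
  (b.count true : ℝ) / (b.length : ℝ) ≤ 1 - 3 / 2 * ε

open Classical in
/-- The loop over the candidate sizes: stop at the first one whose samples pass the test
`reducedMean`, otherwise keep the last one. -/
noncomputable def chooseSize (ε : ℝ) : ℕ → List (ℕ × List Bool) → ℕ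
  | last, [] => last
  | _, (t, b) :: l => if reducedMean ε b then t else chooseSize ε t l

/-- The main loop of Threshold-Sampling-For-Cover, for at most the given number of rounds.
`S` is the current solution, including what was selected before the subroutine was called, and
`L` is the target for `f S`, so that `L - f S` is the remaining gap. The samples for all candidate
sizes `t` are evaluated together in a single adaptive round. -/
noncomputable def thresholdLoop {α : Type u} [DecidableEq α] (L : ℤ) (τ ε εh δh : ℝ) (m : ℕ) :
    ℕ → Finset α → Finset α → AdaptiveAlg α (Finset α)
  | 0, S, _ => .ret S
  | r + 1, S, A =>
    .query (insert S (A.image fun x => S ∪ {x})) fun v =>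
      let A' := A.filter fun x => τ ≤ ((marginalGain v {x} S : ℤ) : ℝ)
      let sizes : List ℕ := (List.range (m + 1)).map fun i => min ⌊(1 + εh) ^ i⌋₊ A'.card
      if A' = ∅ then .ret S else
      .draw (independentDraws (sizes.map fun t =>
          independentDraws (List.replicate (numSamples εh δh) (sampleD A' t)))) fun samples =>
      .query (samples.flatten.toFinset.biUnion fun p => {S ∪ p.1, S ∪ p.1 ∪ p.2}) fun w =>
      let t := chooseSize εh 0 (sizes.zip (samples.map fun l =>
          l.map fun p => decide (τ ≤ ((marginalGain w p.2 (S ∪ p.1) : ℤ) : ℝ))))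
      .draw (uniformSubset A' (min t ⌊((L - v S : ℤ) : ℝ) / ((1 - ε) * τ)⌋₊)) fun T =>
      .query {S ∪ T} fun u =>
      if L ≤ u (S ∪ T) then .ret (S ∪ T) else thresholdLoop L τ ε εh δh m r (S ∪ T) A'

/-- Threshold-Sampling-For-Cover with threshold `τ`, error `ε` and failure probability `δ`, applied
to the marginal function of `f` at `S₀`; it returns `S₀` together with the elements that it
selects. -/
noncomputable def thresholdSamplingForCover {α : Type u} [Fintype α] [DecidableEq α]
    (L : ℤ) (S₀ : Finset α) (τ ε δ : ℝ) : AdaptiveAlg α (Finset α) :=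
  let n : ℝ := Fintype.card α
  let εh : ℝ := ε / 3
  let r : ℕ := ⌈Real.logb (1 - εh)⁻¹ (2 * n / δ)⌉₊
  let m : ℕ := ⌈Real.logb (1 + εh) n⌉₊
  let δh : ℝ := δ / (2 * r * (m + 1))
  thresholdLoop L τ ε εh δh m r S₀ Finset.univ

/-- The loop of Adaptive-Greedy-Cover: call the subroutine at the threshold `τ`, stop if the target
is reached, and otherwise go on with the threshold `(1 - ε) τ`. -/
noncomputable def greedyLoop {α : Type u} [Fintype α] [DecidableEq α] (L : ℤ) (ε δ : ℝ) :
    ℕ → ℝ → Finset α → AdaptiveAlg α (Finset α)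
  | 0, _, S => .ret S
  | j + 1, τ, S =>
    (thresholdSamplingForCover L S τ ε δ).bind fun S' =>
    .query {S'} fun v => if L ≤ v S' then .ret S' else greedyLoop L ε δ j ((1 - ε) * τ) S'

open Classical in
/-- A singleton of maximum value. -/
noncomputable def bestSingleton {α : Type u} [Fintype α] (v : Finset α → ℤ) : Finset α :=
  if h : Nonempty α then
    {(@Finite.exists_max α ℤ _ h _ fun x => v {x}).choose}
  else ∅

/-- Adaptive-Greedy-Cover with target `L`: with `Δ* = max_x f({x})`, return a best singleton if
`Δ* ≥ L`; otherwise call Threshold-Sampling-For-Cover at the thresholds `Δ* (1 - ε) ^ i`,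
`i = 0, …, m`, where `ε = 1/2`, `m = ⌈log(Δ*) / ε⌉` and `δ = 1 / (n (m + 1))`. -/
noncomputable def adaptiveGreedyCover (α : Type u) [Fintype α] [DecidableEq α] (L : ℤ) :
    AdaptiveAlg α (Finset α) :=
  .query (Finset.univ.image fun x : α => {x}) fun v =>
  let X := bestSingleton v
  let Δ : ℝ := ((v X : ℤ) : ℝ)
  if L ≤ v X then .ret X else
  let ε : ℝ := 1 / 2
  let m : ℕ := ⌈Real.log Δ / ε⌉₊
  let δ : ℝ := 1 / ((Fintype.card α : ℝ) * (m + 1))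
  greedyLoop L ε δ (m + 1) Δ ∅

/-- Adaptive-Greedy-Cover, completed so that it never misses the target: its output `S` is checked
and, in the event that `f S < L`, replaced by the whole ground set. -/
noncomputable def completedGreedyCover (α : Type u) [Fintype α] [DecidableEq α] (L : ℤ) :
    AdaptiveAlg α (Finset α) :=
  (adaptiveGreedyCover α L).bind fun S =>
  .query {S} fun v => if L ≤ v S then .ret S else .ret Finset.univ

end SubmodularCover

/-! Fix a threshold `τ` and call an element a survivor if its gain over `S` is at least `τ`. Draw a
random set `T` of `k` survivors and one further survivor `x`; by submodularity, the probability that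
`x` still gains `τ` over `S ∪ T` does not increase with `k` (`goodProb_antitone`). Exponential
concentration and a union bound over the size grid show that, outside a rare event, the chosen size
`t` has two properties (`expectation_not_isGoodSize_le`): some size `s`, smaller than `t` by a
factor of about 7/6 at most, has success probability at least 17/24; and at `t` itself the
probability is at most 5/6, unless `t` exhausts the survivors.

The second property makes an uncapped step shrink the expected number of survivors by the factor
5/6. When the cap cuts the step short, the first property serves instead: so many added elements are
useful that the target is usually reached. Both cases are `subsetMean_unresolved_le`. Survivors are
no longer counted once `2 * gap < τ`, because the cap is then zero. Hence logarithmically many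
iterations leave nothing unresolved, up to probability `δ`.

The size is paid for by the potential `1 + log gap`, set to 0 at the target. If all gains are below
`τ`, the gap is at most `k* τ`, since an optimal cover has `k*` elements. At the next threshold `τ /
2` an element with gain at least `τ / 2` therefore closes a fraction of order `1 / k*` of the gap,
and `14 k*` times the expected drop of the potential covers the expected number of added elements
(`add_subsetMean_potential_le`). The potential starts at `1 + log L` or less, which gives the bound
`O(k* log L)`; a bad event costs at most `n` elements, and the bad events have total probability
`O(1 / n)`.

The last threshold is at most 1, and integer gains below 1 vanish, so success of the last call means
that the target is met. The bounds on rounds and queries hold on every outcome and follow from the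
shape of the program. -/

set_option linter.unusedSectionVars false

open scoped ENNReal

/-! ### Expectations under probability mass functions -/

/-- The expectation of a nonnegative function under a probability mass function. -/
noncomputable def PMF.expectation {ι : Type*} (μ : PMF ι) (φ : ι → ℝ≥0∞) : ℝ≥0∞ :=
  ∑' i, μ i * φ i

namespace PMF

variable {ι κ : Type*}

theorem expectation_pure (a : ι) (φ : ι → ℝ≥0∞) : (PMF.pure a).expectation φ = φ a := by
  classical
  unfold expectation
  rw [tsum_eq_single a]
  · simp
  · intro b hb
    simp [PMF.pure_apply, hb]

theorem expectation_bind (μ : PMF ι) (k : ι → PMF κ) (φ : κ → ℝ≥0∞) :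
    (μ.bind k).expectation φ = μ.expectation fun i => (k i).expectation φ := by
  unfold expectation
  simp only [PMF.bind_apply, ← ENNReal.tsum_mul_right, ← ENNReal.tsum_mul_left]
  rw [ENNReal.tsum_comm]
  simp only [mul_assoc]

theorem expectation_map (μ : PMF ι) (g : ι → κ) (φ : κ → ℝ≥0∞) :
    (μ.map g).expectation φ = μ.expectation fun i => φ (g i) := by
  rw [← PMF.bind_pure_comp, expectation_bind]
  simp [expectation_pure]

theorem expectation_mono {μ : PMF ι} {φ ψ : ι → ℝ≥0∞} (h : ∀ i ∈ μ.support, φ i ≤ ψ i) :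
    μ.expectation φ ≤ μ.expectation ψ := by
  refine ENNReal.tsum_le_tsum fun i => ?_
  by_cases hi : μ i = 0
  · simp [hi]
  · gcongr
    exact h i ((PMF.mem_support_iff _ _).2 hi)

theorem expectation_congr {μ : PMF ι} {φ ψ : ι → ℝ≥0∞} (h : ∀ i ∈ μ.support, φ i = ψ i) :
    μ.expectation φ = μ.expectation ψ :=
  le_antisymm (expectation_mono fun i hi => (h i hi).le) (expectation_mono fun i hi => (h i hi).ge)

theorem expectation_const (μ : PMF ι) (c : ℝ≥0∞) : (μ.expectation fun _ => c) = c := by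
  simp [expectation, ENNReal.tsum_mul_right, PMF.tsum_coe]

theorem expectation_add (μ : PMF ι) (φ ψ : ι → ℝ≥0∞) :
    (μ.expectation fun i => φ i + ψ i) = μ.expectation φ + μ.expectation ψ := by
  simp [expectation, mul_add, ENNReal.tsum_add]

theorem expectation_const_mul (μ : PMF ι) (c : ℝ≥0∞) (φ : ι → ℝ≥0∞) :
    (μ.expectation fun i => c * φ i) = c * μ.expectation φ := by
  simp [expectation, ← ENNReal.tsum_mul_left, mul_left_comm]

theorem expectation_le_const {μ : PMF ι} {φ : ι → ℝ≥0∞} {c : ℝ≥0∞}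
    (h : ∀ i ∈ μ.support, φ i ≤ c) : μ.expectation φ ≤ c :=
  (expectation_mono h).trans (expectation_const μ c).le

/-- A function that is at most `a` on an event and at most `a + b` elsewhere. -/
theorem expectation_le_add_mul (μ : PMF ι) (p : ι → Prop) [DecidablePred p] {φ : ι → ℝ≥0∞}
    {a b η : ℝ≥0∞} (h₁ : ∀ i ∈ μ.support, p i → φ i ≤ a) (h₂ : ∀ i ∈ μ.support, φ i ≤ a + b)
    (hη : (μ.expectation fun i => if p i then 0 else 1) ≤ η) :
    μ.expectation φ ≤ a + b * η := by
  calc μ.expectation φ ≤ μ.expectation fun i => a + b * (if p i then 0 else 1) := by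
        refine expectation_mono fun i hi => ?_
        by_cases hp : p i
        · simpa [hp] using h₁ i hi hp
        · simpa [hp] using h₂ i hi
    _ = a + b * μ.expectation fun i => if p i then 0 else 1 := by
        rw [expectation_add, expectation_const, expectation_const_mul]
    _ ≤ a + b * η := by gcongr

end PMF

namespace AdaptiveAlg

variable {α β γ : Type u} [DecidableEq α]

/-- The expectation of a nonnegative function of the result of an algorithm. -/
noncomputable def expect (f : Finset α → ℤ) (φ : β → ℝ≥0∞) : AdaptiveAlg α β → ℝ≥0∞
  | ret b => φ b
  | draw μ k => μ.expectation fun i => expect f φ (k i)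
  | query Q k => expect f φ (k fun S => if S ∈ Q then f S else 0)

/-- Allows all later arguments to recurse on the program through `expect`, which ignores the batch
sizes. Values in `ℝ≥0∞` avoid every summability question; real numbers return only in
`expectedSize_le` and `le_coverProb`. -/
theorem expectation_law (f : Finset α → ℤ) (φ : β → ℝ≥0∞) (a : AdaptiveAlg α β) :
    (law f a).expectation φ = expect f φ a := by
  unfold law
  rw [PMF.expectation_map]
  induction a with
  | ret b => simp [run, expect, PMF.expectation_pure]
  | draw μ k ih => simp [run, expect, PMF.expectation_bind, ih]
  | query Q k ih => simp [run, expect, PMF.expectation_map, ih]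

theorem expect_bind (f : Finset α → ℤ) (φ : γ → ℝ≥0∞) (a : AdaptiveAlg α β)
    (g : β → AdaptiveAlg α γ) :
    expect f φ (a.bind g) = expect f (fun b => expect f φ (g b)) a := by
  induction a with
  | ret b => rfl
  | draw μ k ih => simp only [bind, expect, ih]
  | query Q k ih => simp only [bind, expect, ih]

theorem expect_mono {f : Finset α → ℤ} {φ ψ : β → ℝ≥0∞} (h : ∀ b, φ b ≤ ψ b)
    (a : AdaptiveAlg α β) : expect f φ a ≤ expect f ψ a := by
  rw [← expectation_law, ← expectation_law]
  exact PMF.expectation_mono fun b _ => h b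

theorem expect_add (f : Finset α → ℤ) (φ ψ : β → ℝ≥0∞) (a : AdaptiveAlg α β) :
    expect f (fun b => φ b + ψ b) a = expect f φ a + expect f ψ a := by
  simp only [← expectation_law, PMF.expectation_add]

theorem expect_const (f : Finset α → ℤ) (c : ℝ≥0∞) (a : AdaptiveAlg α β) :
    expect f (fun _ => c) a = c := by
  simp only [← expectation_law, PMF.expectation_const]

theorem expect_const_mul (f : Finset α → ℤ) (c : ℝ≥0∞) (φ : β → ℝ≥0∞) (a : AdaptiveAlg α β) :
    expect f (fun b => c * φ b) a = c * expect f φ a := by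
  simp only [← expectation_law, PMF.expectation_const_mul]

theorem expect_le_const {f : Finset α → ℤ} {φ : β → ℝ≥0∞} {c : ℝ≥0∞} (h : ∀ b, φ b ≤ c)
    (a : AdaptiveAlg α β) : expect f φ a ≤ c :=
  (expect_mono h a).trans (expect_const f c a).le

theorem expectedSize_le [Fintype α] {f : Finset α → ℤ} {a : AdaptiveAlg α (Finset α)} {c : ℝ}
    (hc : 0 ≤ c) (h : expect f (fun S => (S.card : ℝ≥0∞)) a ≤ ENNReal.ofReal c) :
    expectedSize f a ≤ c := by
  rw [← expectation_law, PMF.expectation, tsum_fintype] at h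
  unfold expectedSize
  have := ENNReal.toReal_mono ENNReal.ofReal_ne_top h
  rw [ENNReal.toReal_ofReal hc, ENNReal.toReal_sum] at this
  · simpa using this
  · intro S _
    exact ENNReal.mul_ne_top (PMF.apply_ne_top _ _) (ENNReal.natCast_ne_top _)

theorem le_coverProb [Fintype α] {f : Finset α → ℤ} {a : AdaptiveAlg α (Finset α)} {L : ℤ} {c : ℝ}
    (hc : 0 ≤ c) (h : expect f (fun S => if L ≤ f S then 0 else 1) a ≤ ENNReal.ofReal c) :
    1 - c ≤ coverProb f a L := by
  rw [← expectation_law, PMF.expectation, tsum_fintype] at h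
  unfold coverProb
  have h1 := ENNReal.toReal_mono ENNReal.ofReal_ne_top h
  rw [ENNReal.toReal_ofReal hc, ENNReal.toReal_sum] at h1
  swap
  · intro S _
    refine ENNReal.mul_ne_top (PMF.apply_ne_top _ _) ?_
    split_ifs <;> simp
  have h2 : ∑ S, (law f a S).toReal = 1 := by
    have := (law f a).tsum_coe
    rw [tsum_fintype] at this
    rw [← ENNReal.toReal_sum (fun S _ => PMF.apply_ne_top _ _), this, ENNReal.toReal_one]
  have h3 : (∑ S, if L ≤ f S then (law f a S).toReal else 0) +
      ∑ S, (law f a S * (if L ≤ f S then 0 else 1)).toReal = 1 := by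
    rw [← h2, ← Finset.sum_add_distrib]
    refine Finset.sum_congr rfl fun S _ => ?_
    split_ifs <;> simp
  linarith

/-! ### Rounds and queries -/

/-- On every outcome at most `R` rounds, with at most `q` queries each. -/
def CostAtMost (f : Finset α → ℤ) (R q : ℕ) (a : AdaptiveAlg α β) : Prop :=
  ∀ o ∈ (run f a).support, o.2.length ≤ R ∧ ∀ b ∈ o.2, b ≤ q

theorem CostAtMost.runsWithin {f : Finset α → ℤ} {R q : ℕ} {a : AdaptiveAlg α β}
    (h : CostAtMost f R q a) {R' q' : ℝ} (hR : (R : ℝ) ≤ R') (hq : (q : ℝ) ≤ q') :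
    RunsWithin f a R' q' := fun o ho =>
  ⟨(Nat.cast_le.2 (h o ho).1).trans hR, fun b hb => (Nat.cast_le.2 ((h o ho).2 b hb)).trans hq⟩

theorem CostAtMost.mono {f : Finset α → ℤ} {R R' q : ℕ} {a : AdaptiveAlg α β}
    (h : CostAtMost f R q a) (hR : R ≤ R') : CostAtMost f R' q a := fun o ho =>
  ⟨(h o ho).1.trans hR, (h o ho).2⟩

theorem costAtMost_ret (f : Finset α → ℤ) (R q : ℕ) (b : β) :
    CostAtMost f R q (ret b : AdaptiveAlg α β) := by
  intro o ho
  simp only [run, PMF.support_pure, Set.mem_singleton_iff] at ho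
  simp [ho]

theorem costAtMost_draw {f : Finset α → ℤ} {R q : ℕ} {ι : Type u} {μ : PMF ι}
    {k : ι → AdaptiveAlg α β} (h : ∀ i ∈ μ.support, CostAtMost f R q (k i)) :
    CostAtMost f R q (draw μ k) := by
  intro o ho
  simp only [run, PMF.mem_support_bind_iff] at ho
  obtain ⟨i, hi, ho⟩ := ho
  exact h i hi o ho

theorem costAtMost_query {f : Finset α → ℤ} {R q : ℕ} {Q : Finset (Finset α)}
    {k : (Finset α → ℤ) → AdaptiveAlg α β} (hQ : Q.card ≤ q)
    (h : CostAtMost f R q (k fun S => if S ∈ Q then f S else 0)) :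
    CostAtMost f (R + 1) q (query Q k) := by
  intro o ho
  simp only [run, PMF.mem_support_map_iff] at ho
  obtain ⟨o', ho', rfl⟩ := ho
  obtain ⟨h1, h2⟩ := h o' ho'
  refine ⟨by simpa using h1, ?_⟩
  simpa [hQ] using h2

/-- An outcome of a composition is an outcome of the first program followed by one of the second.
This makes round counts additive, and it lets the final check be examined on every single outcome.
-/
theorem exists_of_mem_support_run_bind {f : Finset α → ℤ} {a : AdaptiveAlg α β}
    {g : β → AdaptiveAlg α γ} {o : γ × List ℕ} (ho : o ∈ (run f (a.bind g)).support) :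
    ∃ o₁ ∈ (run f a).support, ∃ o₂ ∈ (run f (g o₁.1)).support,
      o.1 = o₂.1 ∧ o.2 = o₁.2 ++ o₂.2 := by
  induction a generalizing o with
  | ret b => exact ⟨(b, []), by simp [run], o, ho, rfl, rfl⟩
  | draw μ k ih =>
    simp only [bind, run, PMF.mem_support_bind_iff] at ho
    obtain ⟨i, hi, ho⟩ := ho
    obtain ⟨o₁, h₁, o₂, h₂, h⟩ := ih i ho
    exact ⟨o₁, by simpa only [run, PMF.mem_support_bind_iff] using ⟨i, hi, h₁⟩, o₂, h₂, h⟩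
  | query Q k ih =>
    simp only [bind, run, PMF.mem_support_map_iff] at ho
    obtain ⟨o', ho', rfl⟩ := ho
    obtain ⟨o₁, h₁, o₂, h₂, h, h'⟩ := ih _ ho'
    refine ⟨(o₁.1, Q.card :: o₁.2), ?_, o₂, h₂, h, by simp [h']⟩
    simpa only [run, PMF.mem_support_map_iff] using ⟨o₁, h₁, rfl⟩

theorem CostAtMost.bind {f : Finset α → ℤ} {R R' q : ℕ} {a : AdaptiveAlg α β}
    {g : β → AdaptiveAlg α γ} (ha : CostAtMost f R q a) (hg : ∀ b, CostAtMost f R' q (g b)) :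
    CostAtMost f (R + R') q (a.bind g) := by
  intro o ho
  obtain ⟨o₁, h₁, o₂, h₂, -, h⟩ := exists_of_mem_support_run_bind ho
  obtain ⟨a1, a2⟩ := ha o₁ h₁
  obtain ⟨b1, b2⟩ := hg _ o₂ h₂
  rw [h, List.length_append]
  refine ⟨by omega, fun b hb => ?_⟩
  rcases List.mem_append.1 hb with hb | hb
  · exact a2 b hb
  · exact b2 b hb

end AdaptiveAlg

/-! ### Uniformly random subsets -/

section RandomSubsets

open Finset

variable {α : Type u} [DecidableEq α]

/-- Double counting: a set of size `k + 1` with a marked element is the same as a set of size `k`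
with a new element. All comparisons between consecutive sizes rest on it. -/
theorem sum_powersetCard_succ (A : Finset α) (k : ℕ) (g : Finset α → α → ℝ) :
    ∑ T ∈ A.powersetCard (k + 1), ∑ x ∈ T, g (T.erase x) x =
      ∑ T ∈ A.powersetCard k, ∑ x ∈ A \ T, g T x := by
  rw [Finset.sum_sigma', Finset.sum_sigma']
  refine Finset.sum_bij' (fun p _ => ⟨p.1.erase p.2, p.2⟩) (fun p _ => ⟨insert p.2 p.1, p.2⟩)
    ?_ ?_ ?_ ?_ ?_
  · rintro ⟨T, x⟩ h
    simp only [mem_sigma, mem_powersetCard, mem_sdiff] at h ⊢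
    refine ⟨⟨(erase_subset _ _).trans h.1.1, ?_⟩, h.1.1 h.2, notMem_erase _ _⟩
    rw [card_erase_of_mem h.2, h.1.2]; rfl
  · rintro ⟨T, x⟩ h
    simp only [mem_sigma, mem_powersetCard, mem_sdiff] at h ⊢
    refine ⟨⟨insert_subset h.2.1 h.1.1, ?_⟩, mem_insert_self _ _⟩
    rw [card_insert_of_notMem h.2.2, h.1.2]
  · rintro ⟨T, x⟩ h
    simp only [mem_sigma] at h
    simp [insert_erase h.2]
  · rintro ⟨T, x⟩ h
    simp only [mem_sigma, mem_sdiff] at h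
    simp [erase_insert h.2.2]
  · rintro ⟨T, x⟩ _
    rfl

open Classical in
/-- The number of pairs `(T, x)` with `T ⊆ A` of size `k` and `x ∈ A \ T` for which `G T x` holds. -/
noncomputable def goodCount (A : Finset α) (G : Finset α → α → Prop) (k : ℕ) : ℝ :=
  ∑ T ∈ A.powersetCard k, ∑ x ∈ A \ T, if G T x then 1 else 0

/-- The probability of `G T x` for `T` uniform among the subsets of `A` of size `k` and `x` uniform
in `A \ T`. -/
noncomputable def goodProb (A : Finset α) (G : Finset α → α → Prop) (k : ℕ) : ℝ :=
  goodCount A G k / ((A.card.choose k : ℝ) * ((A.card : ℝ) - k))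

/-- The mean of `c T` for `T` uniform among the subsets of `A` of size `k`. -/
noncomputable def subsetMean (A : Finset α) (k : ℕ) (c : Finset α → ℝ) : ℝ :=
  (∑ T ∈ A.powersetCard k, c T) / (A.card.choose k : ℝ)

theorem goodCount_nonneg (A : Finset α) (G : Finset α → α → Prop) (k : ℕ) :
    0 ≤ goodCount A G k :=
  sum_nonneg fun _ _ => sum_nonneg fun _ _ => by split_ifs <;> simp

theorem card_sdiff_of_mem_powersetCard {A T : Finset α} {k : ℕ} (hT : T ∈ A.powersetCard k) :
    ((A \ T).card : ℝ) = A.card - k := by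
  obtain ⟨h, h'⟩ := mem_powersetCard.1 hT
  rw [card_sdiff_of_subset h, h', Nat.cast_sub (h' ▸ card_le_card h)]

theorem goodCount_le (A : Finset α) (G : Finset α → α → Prop) (k : ℕ) :
    goodCount A G k ≤ (A.card.choose k : ℝ) * ((A.card : ℝ) - k) := by
  unfold goodCount
  calc _ ≤ ∑ T ∈ A.powersetCard k, ∑ x ∈ A \ T, (1 : ℝ) := by
        gcongr; split_ifs <;> simp
    _ = ∑ T ∈ A.powersetCard k, ((A.card : ℝ) - k) := by
        refine sum_congr rfl fun T hT => ?_
        rw [sum_const, nsmul_eq_mul, mul_one, card_sdiff_of_mem_powersetCard hT]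
    _ = _ := by rw [sum_const, card_powersetCard, nsmul_eq_mul]

theorem choose_mul_pos {A : Finset α} {k : ℕ} (hk : k < A.card) :
    0 < (A.card.choose k : ℝ) * ((A.card : ℝ) - k) := by
  have h1 : (0 : ℝ) < A.card.choose k := by exact_mod_cast Nat.choose_pos hk.le
  have h2 : (k : ℝ) < A.card := by exact_mod_cast hk
  exact mul_pos h1 (sub_pos.2 h2)

theorem goodProb_nonneg {A : Finset α} (G : Finset α → α → Prop) {k : ℕ} (hk : k < A.card) :
    0 ≤ goodProb A G k :=
  div_nonneg (goodCount_nonneg _ _ _) (choose_mul_pos hk).le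

theorem goodProb_le_one {A : Finset α} (G : Finset α → α → Prop) {k : ℕ} (hk : k < A.card) :
    goodProb A G k ≤ 1 :=
  div_le_one_of_le₀ (goodCount_le _ _ _) (choose_mul_pos hk).le

theorem choose_succ_mul (n k : ℕ) :
    ((k : ℝ) + 1) * n.choose (k + 1) = (n.choose k : ℝ) * ((n : ℝ) - k) := by
  rcases le_or_gt k n with h | h
  · have := Nat.choose_succ_right_eq n k
    rw [← Nat.cast_sub h]
    exact_mod_cast (by rw [← this]; ring)
  · rw [Nat.choose_eq_zero_of_lt h, Nat.choose_eq_zero_of_lt (by omega)]; simp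

/-- Count each good pair `(T, x)` once for every `y ∈ T` and delete `y` from `T`: the pair stays
good by `hG`. Conversely, for a pair `(T, x)` with `T` of size `k`, there are `|A| - (k + 1)`
choices of `y` outside `T` and different from `x`. -/
theorem mul_goodCount_succ_le {A : Finset α} {G : Finset α → α → Prop}
    (hG : ∀ T T' x, T ⊆ T' → x ∉ T' → G T' x → G T x) (k : ℕ) :
    ((k : ℝ) + 1) * goodCount A G (k + 1) ≤ ((A.card : ℝ) - (k + 1)) * goodCount A G k := by
  classical
  unfold goodCount
  calc _ = ∑ T ∈ A.powersetCard (k + 1), ∑ y ∈ T, ∑ x ∈ A \ T, (if G T x then (1 : ℝ) else 0) := by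
        rw [mul_sum]
        refine sum_congr rfl fun T hT => ?_
        rw [sum_const, (mem_powersetCard.1 hT).2, nsmul_eq_mul]; push_cast; rfl
    _ ≤ ∑ T ∈ A.powersetCard (k + 1), ∑ y ∈ T, ∑ x ∈ A \ (insert y (T.erase y)),
          (if G (T.erase y) x then (1 : ℝ) else 0) := by
        refine sum_le_sum fun T _ => sum_le_sum fun y hy => ?_
        rw [insert_erase hy]
        refine sum_le_sum fun x hx => ?_
        by_cases h : G T x
        · simp [h, hG _ _ _ (erase_subset y T) (mem_sdiff.1 hx).2 h]
        · simp only [h, if_false]; split_ifs <;> simp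
    _ = ∑ T ∈ A.powersetCard k, ∑ y ∈ A \ T, ∑ x ∈ A \ (insert y T),
          (if G T x then (1 : ℝ) else 0) :=
        sum_powersetCard_succ A k fun T y => ∑ x ∈ A \ (insert y T), if G T x then (1 : ℝ) else 0
    _ = _ := by
        rw [mul_sum]
        refine sum_congr rfl fun T hT => ?_
        have : ∀ y, A \ insert y T = (A \ T).erase y := fun y => by
          ext x; simp only [mem_sdiff, mem_insert, mem_erase]; tauto
        simp only [this]
        rw [sum_comm' (t' := A \ T) (s' := fun x => (A \ T).erase x)
          (by intro x y; simp only [mem_erase]; tauto), mul_sum]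
        refine sum_congr rfl fun x hx => ?_
        rw [sum_const, nsmul_eq_mul, card_erase_of_mem hx, Nat.cast_sub
          (card_pos.2 ⟨x, hx⟩), card_sdiff_of_mem_powersetCard hT]
        push_cast; ring

theorem goodProb_succ_le {A : Finset α} {G : Finset α → α → Prop}
    (hG : ∀ T T' x, T ⊆ T' → x ∉ T' → G T' x → G T x) {k : ℕ} (hk : k + 1 < A.card) :
    goodProb A G (k + 1) ≤ goodProb A G k := by
  unfold goodProb
  have h1 := choose_mul_pos hk
  have h0 := choose_mul_pos (A := A) (k := k) (by omega)
  rw [div_le_div_iff₀ h1 h0, ← choose_succ_mul A.card k]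
  have := mul_goodCount_succ_le hG (A := A) k
  have hc : (0 : ℝ) ≤ A.card.choose (k + 1) := by positivity
  push_cast
  nlinarith

theorem goodProb_antitone {A : Finset α} {G : Finset α → α → Prop}
    (hG : ∀ T T' x, T ⊆ T' → x ∉ T' → G T' x → G T x) {j k : ℕ} (hjk : j ≤ k)
    (hk : k < A.card) : goodProb A G k ≤ goodProb A G j := by
  induction k, hjk using Nat.le_induction with
  | base => rfl
  | succ k _ ih => exact (goodProb_succ_le hG hk).trans (ih (by omega))

/-- After a random subset of size `k + 1` is removed, the number of good elements that are left
drops by the factor `goodProb A G k`. -/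
theorem goodCount_succ_div_le {A : Finset α} {G : Finset α → α → Prop}
    (hG : ∀ T T' x, T ⊆ T' → x ∉ T' → G T' x → G T x) {k : ℕ} (hk : k < A.card) :
    goodCount A G (k + 1) / (A.card.choose (k + 1) : ℝ) ≤
      ((A.card : ℝ) - (k + 1)) * goodProb A G k := by
  have h0 := choose_mul_pos hk
  have h1 : (0 : ℝ) < A.card.choose (k + 1) := by exact_mod_cast Nat.choose_pos hk
  unfold goodProb
  rw [← mul_div_assoc, div_le_div_iff₀ h1 h0, ← choose_succ_mul A.card k]
  have := mul_goodCount_succ_le hG (A := A) k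
  nlinarith

/-- A uniform set of size `k + 1` arises from a uniform set of size `k` by adding a uniform new
element, and `c` grows by at least 1 whenever that element is good. -/
theorem subsetMean_succ_ge {A : Finset α} {G : Finset α → α → Prop} [∀ T x, Decidable (G T x)]
    {c : Finset α → ℝ}
    (hc : ∀ T x, x ∉ T → c T + (if G T x then 1 else 0) ≤ c (insert x T)) {k : ℕ}
    (hk : k < A.card) :
    subsetMean A k c + goodProb A G k ≤ subsetMean A (k + 1) c := by
  have h0 := choose_mul_pos hk
  have h1 : (0 : ℝ) < A.card.choose (k + 1) := by exact_mod_cast Nat.choose_pos hk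
  have hk1 : (0 : ℝ) < (k : ℝ) + 1 := by positivity
  have h2 : (0 : ℝ) < A.card.choose k := by exact_mod_cast Nat.choose_pos hk.le
  have h3 : (0 : ℝ) < (A.card : ℝ) - k := sub_pos.2 (by exact_mod_cast hk)
  have key : ((A.card : ℝ) - k) * (∑ T ∈ A.powersetCard k, c T) + goodCount A G k ≤
      ((k : ℝ) + 1) * ∑ T ∈ A.powersetCard (k + 1), c T := by
    calc _ = ∑ T ∈ A.powersetCard k, ∑ x ∈ A \ T, (c T + if G T x then 1 else 0) := by
          unfold goodCount
          rw [mul_sum, ← sum_add_distrib]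
          refine sum_congr rfl fun T hT => ?_
          rw [sum_add_distrib, sum_const, nsmul_eq_mul, card_sdiff_of_mem_powersetCard hT]
          congr 1
          exact sum_congr rfl fun x _ => by congr
      _ ≤ ∑ T ∈ A.powersetCard k, ∑ x ∈ A \ T, c (insert x T) := by
          refine sum_le_sum fun T _ => sum_le_sum fun x hx => hc _ _ (mem_sdiff.1 hx).2
      _ = ∑ T ∈ A.powersetCard (k + 1), ∑ x ∈ T, c (insert x (T.erase x)) :=
          (sum_powersetCard_succ A k fun T x => c (insert x T)).symm
      _ = _ := by
          rw [mul_sum]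
          refine sum_congr rfl fun T hT => ?_
          rw [sum_congr rfl fun x hx => by rw [insert_erase hx], sum_const,
            (mem_powersetCard.1 hT).2, nsmul_eq_mul]
          push_cast; rfl
  unfold subsetMean goodProb
  have e1 : (∑ T ∈ A.powersetCard (k + 1), c T) / (A.card.choose (k + 1) : ℝ) =
      (((k : ℝ) + 1) * ∑ T ∈ A.powersetCard (k + 1), c T) /
        ((A.card.choose k : ℝ) * ((A.card : ℝ) - k)) := by
    rw [← choose_succ_mul, mul_div_mul_left _ _ hk1.ne']
  have e2 : (∑ T ∈ A.powersetCard k, c T) / (A.card.choose k : ℝ) =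
      (((A.card : ℝ) - k) * ∑ T ∈ A.powersetCard k, c T) /
        ((A.card.choose k : ℝ) * ((A.card : ℝ) - k)) := by
    rw [mul_comm, mul_div_mul_right _ _ h3.ne']
  rw [e1, e2, ← add_div]
  gcongr

/-- Telescoping over the elements added one by one: each of the first `s + 1` is good with
probability at least `goodProb A G s` by antitonicity, and later ones do not decrease the mean. -/
theorem min_mul_goodProb_le_subsetMean {A : Finset α} {G : Finset α → α → Prop}
    [∀ T x, Decidable (G T x)]
    (hG : ∀ T T' x, T ⊆ T' → x ∉ T' → G T' x → G T x) {c : Finset α → ℝ} (h0 : 0 ≤ c ∅)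
    (hc : ∀ T x, x ∉ T → c T + (if G T x then 1 else 0) ≤ c (insert x T)) {s : ℕ}
    (hs : s < A.card) {k : ℕ} (hk : k ≤ A.card) :
    (min k (s + 1) : ℕ) * goodProb A G s ≤ subsetMean A k c := by
  induction k with
  | zero => simpa [subsetMean] using h0
  | succ k ih =>
    have h1 := ih (by omega)
    have h2 := subsetMean_succ_ge (A := A) hc (k := k) (by omega)
    have h3 := goodProb_nonneg (A := A) G (k := k) (by omega)
    rcases le_or_gt k s with h | h
    · have h4 := goodProb_antitone hG h hs
      rw [min_eq_left (by omega)] at h1 ⊢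
      push_cast
      nlinarith
    · rw [min_eq_right (by omega)] at h1 ⊢
      linarith

theorem subsetMean_mono {A : Finset α} {k : ℕ} {c d : Finset α → ℝ}
    (h : ∀ T ∈ A.powersetCard k, c T ≤ d T) : subsetMean A k c ≤ subsetMean A k d := by
  unfold subsetMean
  gcongr with T hT
  exact h T hT

theorem subsetMean_const {A : Finset α} {k : ℕ} (hk : k ≤ A.card) (a : ℝ) :
    subsetMean A k (fun _ => a) = a := by
  have h1 : (A.card.choose k : ℝ) ≠ 0 := by exact_mod_cast (Nat.choose_pos hk).ne'
  unfold subsetMean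
  rw [sum_const, card_powersetCard, nsmul_eq_mul, mul_div_cancel_left₀ _ h1]

theorem subsetMean_add (A : Finset α) (k : ℕ) (c d : Finset α → ℝ) :
    subsetMean A k (fun T => c T + d T) = subsetMean A k c + subsetMean A k d := by
  simp [subsetMean, sum_add_distrib, add_div]

theorem subsetMean_sub (A : Finset α) (k : ℕ) (c d : Finset α → ℝ) :
    subsetMean A k (fun T => c T - d T) = subsetMean A k c - subsetMean A k d := by
  simp [subsetMean, sum_sub_distrib, sub_div]

theorem subsetMean_const_mul (A : Finset α) (k : ℕ) (a : ℝ) (c : Finset α → ℝ) :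
    subsetMean A k (fun T => a * c T) = a * subsetMean A k c := by
  simp [subsetMean, ← mul_sum, mul_div_assoc]

end RandomSubsets

/-! ### The algorithm's random sets expressed through `subsetMean` and `goodProb` -/

namespace SubmodularCover

variable {α : Type u} [DecidableEq α]

theorem expectation_uniformSubset {A : Finset α} {k : ℕ} (hk : k ≤ A.card)
    {c : Finset α → ℝ} (hc : ∀ T ∈ A.powersetCard k, 0 ≤ c T) :
    ((uniformSubset A k).expectation fun T => ENNReal.ofReal (c T)) =
      ENNReal.ofReal (subsetMean A k c) := by
  have hne : (A.powersetCard k).Nonempty := Finset.powersetCard_nonempty.2 hk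
  have hpos : (0 : ℝ) < A.card.choose k := by exact_mod_cast Nat.choose_pos hk
  unfold uniformSubset PMF.expectation subsetMean
  rw [dif_pos hne, tsum_eq_sum (s := A.powersetCard k)]
  · rw [ENNReal.ofReal_div_of_pos hpos, ENNReal.ofReal_sum_of_nonneg hc, div_eq_mul_inv,
      Finset.sum_mul]
    refine Finset.sum_congr rfl fun T hT => ?_
    rw [PMF.uniformOfFinset_apply_of_mem _ hT, Finset.card_powersetCard, mul_comm,
      ENNReal.ofReal_natCast]
  · intro T hT
    rw [PMF.uniformOfFinset_apply_of_notMem _ hT, zero_mul]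

theorem mem_support_uniformSubset {A : Finset α} {k : ℕ} (hk : k ≤ A.card) {T : Finset α} :
    T ∈ (uniformSubset A k).support ↔ T ⊆ A ∧ T.card = k := by
  have hne : (A.powersetCard k).Nonempty := Finset.powersetCard_nonempty.2 hk
  unfold uniformSubset
  rw [dif_pos hne, PMF.mem_support_uniformOfFinset_iff, Finset.mem_powersetCard]

theorem sum_powersetCard_one (B : Finset α) (g : Finset α → ℝ) :
    ∑ X ∈ B.powersetCard 1, g X = ∑ x ∈ B, g {x} := by
  rw [Finset.powersetCard_one, Finset.sum_map]; rfl

/-- The probability that a sample from `sampleD A (k + 1)` is good. -/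
theorem expectation_sampleD {A : Finset α} {k : ℕ} (hk : k < A.card)
    (G : Finset α → Finset α → Prop) [∀ T X, Decidable (G T X)] :
    ((sampleD A (k + 1)).expectation fun p => if G p.1 p.2 then 1 else 0) =
      ENNReal.ofReal (goodProb A (fun T x => G T {x}) k) := by
  have h3 : (0 : ℝ) < (A.card : ℝ) - k := sub_pos.2 (by exact_mod_cast hk)
  unfold sampleD
  rw [PMF.expectation_bind, Nat.add_sub_cancel]
  simp only [PMF.expectation_map]
  calc _ = (uniformSubset A k).expectation fun T => ENNReal.ofReal
        (subsetMean (A \ T) 1 fun X => if G T X then 1 else 0) := by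
        refine PMF.expectation_congr fun T hT => ?_
        have hT' := (mem_support_uniformSubset hk.le).1 hT
        rw [← expectation_uniformSubset]
        · refine PMF.expectation_congr fun X _ => ?_
          split_ifs <;> simp
        · rw [Finset.card_sdiff_of_subset hT'.1]; omega
        · intro X _; split_ifs <;> simp
    _ = _ := by
        rw [expectation_uniformSubset hk.le]
        · congr 1
          unfold subsetMean goodProb goodCount
          rw [mul_comm (A.card.choose k : ℝ), ← div_div]
          congr 1
          rw [Finset.sum_div]
          refine Finset.sum_congr rfl fun T hT => ?_
          dsimp only
          rw [sum_powersetCard_one, Nat.choose_one_right, card_sdiff_of_mem_powersetCard hT]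
          congr 1
          exact Finset.sum_congr rfl fun x _ => by congr
        · intro T _
          unfold subsetMean
          refine div_nonneg (Finset.sum_nonneg fun X _ => ?_) (by positivity)
          split_ifs <;> simp

end SubmodularCover

/-! ### Concentration of empirical means -/

/-- Moment bound for a centred Bernoulli variable: `exp u ≤ 1 + u + u ^ 2` for `|u| ≤ 1`, the linear
terms cancel, and the variance `p * (1 - p)` is at most 1/4. -/
theorem mul_exp_add_mul_exp_le {p t : ℝ} (h0 : 0 ≤ p) (h1 : p ≤ 1) (ht : |t| ≤ 1) :
    p * Real.exp (t * (1 - p)) + (1 - p) * Real.exp (t * (0 - p)) ≤ Real.exp (t ^ 2 / 4) := by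
  have key : ∀ u : ℝ, |u| ≤ 1 → Real.exp u ≤ 1 + u + u ^ 2 := fun u hu => by
    have := (abs_le.1 (Real.abs_exp_sub_one_sub_id_le hu)).2
    linarith
  have b1 : |t * (1 - p)| ≤ 1 := by
    rw [abs_mul]
    exact mul_le_one₀ ht (abs_nonneg _) (abs_le.2 ⟨by linarith, by linarith⟩)
  have b2 : |t * (0 - p)| ≤ 1 := by
    rw [abs_mul]
    exact mul_le_one₀ ht (abs_nonneg _) (abs_le.2 ⟨by linarith, by linarith⟩)
  have e := Real.add_one_le_exp (t ^ 2 / 4)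
  have hp : p * (1 - p) ≤ 1 / 4 := by nlinarith [sq_nonneg (p - 1 / 2)]
  calc _ ≤ p * (1 + t * (1 - p) + (t * (1 - p)) ^ 2) +
        (1 - p) * (1 + t * (0 - p) + (t * (0 - p)) ^ 2) := by
        have := key _ b1
        have := key _ b2
        have : 0 ≤ 1 - p := by linarith
        gcongr
    _ = 1 + t ^ 2 * (p * (1 - p)) := by ring
    _ ≤ _ := by nlinarith [sq_nonneg t]

namespace SubmodularCover

section IndependentDraws

variable {β : Type u}

theorem forall₂_of_mem_support_independentDraws {μs : List (PMF β)} {l : List β}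
    (h : l ∈ (independentDraws μs).support) : List.Forall₂ (fun μ b => b ∈ μ.support) μs l := by
  induction μs generalizing l with
  | nil =>
    simp only [independentDraws, PMF.support_pure, Set.mem_singleton_iff] at h
    subst h
    exact List.Forall₂.nil
  | cons μ μs ih =>
    simp only [independentDraws, PMF.mem_support_bind_iff, PMF.mem_support_map_iff] at h
    obtain ⟨b, hb, bs, hbs, rfl⟩ := h
    exact List.Forall₂.cons hb (ih hbs)

theorem length_of_mem_support_independentDraws {μs : List (PMF β)} {l : List β}
    (h : l ∈ (independentDraws μs).support) : l.length = μs.length :=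
  (forall₂_of_mem_support_independentDraws h).length_eq.symm

theorem expectation_prod_independentDraws (ν : PMF β) (w : β → ℝ≥0∞) (N : ℕ) :
    ((independentDraws (List.replicate N ν)).expectation fun l => (l.map w).prod) =
      ν.expectation w ^ N := by
  induction N with
  | zero => simp [independentDraws, PMF.expectation_pure]
  | succ N ih =>
    simp only [List.replicate_succ, independentDraws, PMF.expectation_bind, PMF.expectation_map,
      List.map_cons, List.prod_cons, PMF.expectation_const_mul, ih]
    rw [pow_succ']
    simp only [mul_comm _ (ν.expectation w ^ N), PMF.expectation_const_mul]

theorem prod_exp_eq (d : β → Bool) (t p : ℝ) (l : List β) :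
    (l.map fun b => ENNReal.ofReal (if d b then Real.exp (t * (1 - p))
      else Real.exp (t * (0 - p)))).prod =
      ENNReal.ofReal (Real.exp (t * ((l.map d).count true - l.length * p))) := by
  induction l with
  | nil => simp
  | cons b l ih =>
    rw [List.map_cons, List.prod_cons, ih, ← ENNReal.ofReal_mul (by split_ifs <;> positivity)]
    congr 1
    cases hb : d b <;> simp [hb, ← Real.exp_add] <;> ring

/-- An empirical mean of `N` samples is off by `e` in the direction `σ` with probability at most
`exp (- N e²)`. -/
theorem expectation_deviation_le {ν : PMF β} {d : β → Bool} {p e σ : ℝ} (h0 : 0 ≤ p) (h1 : p ≤ 1)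
    (hν : (ν.expectation fun b => if d b then 1 else 0) = ENNReal.ofReal p)
    (he0 : 0 ≤ e) (he : e ≤ 1 / 2) (hσ : |σ| = 1) (N : ℕ) :
    ((independentDraws (List.replicate N ν)).expectation fun l =>
      open Classical in
      if N * e ≤ σ * ((l.map d).count true - N * p) then 1 else 0) ≤
      ENNReal.ofReal (Real.exp (-(N * e ^ 2))) := by
  classical
  have hσ2 : σ ^ 2 = 1 := by rw [← sq_abs, hσ, one_pow]
  -- Chernoff's method: `|t| = 2 * e` minimises `t ^ 2 / 4 - |t| * e`, with minimum `-e ^ 2`. The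
  -- assumption `e ≤ 1 / 2` keeps `|t| ≤ 1`, as the moment bound needs.
  set t : ℝ := 2 * e * σ with ht
  have htabs : |t| ≤ 1 := by
    rw [ht, abs_mul, hσ, abs_of_nonneg (by linarith)]; linarith
  have ht2 : t ^ 2 / 4 = e ^ 2 := by rw [ht]; linear_combination e ^ 2 * hσ2
  set w : β → ℝ≥0∞ := fun b => ENNReal.ofReal (if d b then Real.exp (t * (1 - p))
      else Real.exp (t * (0 - p))) with hw
  have hνc : (ν.expectation fun b => if d b then 0 else 1) = ENNReal.ofReal (1 - p) := by
    have h := PMF.expectation_const ν 1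
    have h' : (ν.expectation fun _ => (1 : ℝ≥0∞)) =
        ν.expectation fun b => (if d b then 1 else 0) + (if d b then 0 else 1) :=
      PMF.expectation_congr fun b _ => by split_ifs <;> simp
    rw [h', PMF.expectation_add, hν] at h
    rw [ENNReal.ofReal_sub _ h0, ENNReal.ofReal_one]
    exact ENNReal.eq_sub_of_add_eq' (by simp) ((add_comm _ _).trans h)
  have hEw : ν.expectation w ≤ ENNReal.ofReal (Real.exp (e ^ 2)) := by
    have : ν.expectation w = ENNReal.ofReal
        (p * Real.exp (t * (1 - p)) + (1 - p) * Real.exp (t * (0 - p))) := by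
      have h1p : 0 ≤ 1 - p := by linarith
      rw [ENNReal.ofReal_add (by positivity) (by positivity), ENNReal.ofReal_mul h0,
        ENNReal.ofReal_mul h1p, ← hν, ← hνc, mul_comm, mul_comm (ν.expectation _),
        ← PMF.expectation_const_mul, ← PMF.expectation_const_mul, ← PMF.expectation_add]
      refine PMF.expectation_congr fun b _ => ?_
      simp only [hw]
      split_ifs <;> simp
    rw [this, ← ht2]
    exact ENNReal.ofReal_le_ofReal (mul_exp_add_mul_exp_le h0 h1 htabs)
  calc _ ≤ (independentDraws (List.replicate N ν)).expectation fun l =>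
        ENNReal.ofReal (Real.exp (-(2 * (N * e ^ 2)))) * (l.map w).prod := by
        refine PMF.expectation_mono fun l hl => ?_
        have hlen := length_of_mem_support_independentDraws hl
        rw [List.length_replicate] at hlen
        rw [hw, prod_exp_eq, hlen, ← ENNReal.ofReal_mul (Real.exp_pos _).le, ← Real.exp_add]
        split_ifs with h
        · rw [← ENNReal.ofReal_one]
          refine ENNReal.ofReal_le_ofReal (Real.one_le_exp ?_)
          have := mul_le_mul_of_nonneg_left h (by linarith : 0 ≤ 2 * e)
          rw [ht]
          linarith
        · exact zero_le
    _ ≤ ENNReal.ofReal (Real.exp (-(2 * (N * e ^ 2)))) *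
          ENNReal.ofReal (Real.exp (e ^ 2)) ^ N := by
        rw [PMF.expectation_const_mul, expectation_prod_independentDraws]
        gcongr
    _ = _ := by
        rw [← ENNReal.ofReal_pow (Real.exp_pos _).le, ← ENNReal.ofReal_mul (Real.exp_pos _).le,
          ← Real.exp_nat_mul, ← Real.exp_add]
        congr 2
        ring

open Classical in
/-- Union bound over independent draws. -/
theorem expectation_not_forall₂_le {ι : Type*} {D : ι → PMF β} {ok : ι → β → Prop} {η : ℝ≥0∞}
    {ts : List ι} (h : ∀ t ∈ ts, ((D t).expectation fun b => if ok t b then 0 else 1) ≤ η) :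
    ((independentDraws (ts.map D)).expectation fun l =>
      if List.Forall₂ ok ts l then 0 else 1) ≤ ts.length * η := by
  induction ts with
  | nil => simp [independentDraws, PMF.expectation_pure]
  | cons t ts ih =>
    simp only [List.map_cons, independentDraws, PMF.expectation_bind, PMF.expectation_map,
      List.forall₂_cons]
    calc _ ≤ (D t).expectation fun b => (if ok t b then 0 else 1) +
          (independentDraws (ts.map D)).expectation fun l =>
            if List.Forall₂ ok ts l then 0 else 1 := by
          refine PMF.expectation_mono fun b _ => ?_
          by_cases hb : ok t b
          · simp [hb]
          · simp only [hb, false_and, if_false, PMF.expectation_const]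
            exact le_self_add
      _ ≤ η + ts.length * η := by
          rw [PMF.expectation_add, PMF.expectation_const]
          gcongr
          · exact h t (by simp)
          · exact ih fun t' ht' => h t' (by simp [ht'])
      _ = _ := by
          rw [List.length_cons]; push_cast; ring

end IndependentDraws

/-- Here `576 = 16 * 36 = 24 ^ 2`: the number of samples is just enough for deviations of 1/24. -/
theorem log_div_le_numSamples {δ : ℝ} : Real.log (2 / δ) ≤ numSamples (1 / 6) δ / 576 := by
  have := Nat.le_ceil (Real.log (2 / δ) / (1 / 6) ^ 2)
  unfold numSamples
  generalize ⌈Real.log (2 / δ) / (1 / 6) ^ 2⌉₊ = M at *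
  rw [div_le_iff₀ (by norm_num)] at this
  push_cast
  linarith

open Classical in
/-- The test of Reduced-Mean is right up to `1 / 24`, with probability at least `1 - δ`. -/
theorem expectation_reducedMean_fails_le {β : Type u} {ν : PMF β} {d : β → Bool} {p δ : ℝ}
    (h0 : 0 ≤ p) (h1 : p ≤ 1)
    (hν : (ν.expectation fun b => if d b then 1 else 0) = ENNReal.ofReal p)
    (hδ0 : 0 < δ) (hδ : δ ≤ 1) :
    ((independentDraws (List.replicate (numSamples (1 / 6) δ) ν)).expectation fun l =>
      if (reducedMean (1 / 6) (l.map d) → p ≤ 5 / 6) ∧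
        (¬ reducedMean (1 / 6) (l.map d) → 17 / 24 ≤ p) then 0 else 1) ≤ ENNReal.ofReal δ := by
  have hN := log_div_le_numSamples (δ := δ)
  set N := numSamples (1 / 6) δ
  have hlog : 0 < Real.log (2 / δ) := Real.log_pos (by rw [lt_div_iff₀ hδ0]; linarith)
  have hNpos : (0 : ℝ) < N := by linarith
  have hexp : Real.exp (-(N * (1 / 24) ^ 2)) ≤ δ / 2 := by
    rw [← Real.le_log_iff_exp_le (by positivity)]
    have : Real.log (δ / 2) = - Real.log (2 / δ) := by rw [← Real.log_inv, inv_div]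
    rw [this]; linarith
  -- The cut is at `1 - 3 / 2 * (1 / 6) = 3 / 4`. Accepting although `p > 5 / 6`, or rejecting
  -- although `p < 17 / 24`, means a deviation of at least 1/24; each direction costs `δ / 2`.
  calc _ ≤ (independentDraws (List.replicate N ν)).expectation fun l =>
        (if N * (1 / 24) ≤ (1 : ℝ) * ((l.map d).count true - N * p) then 1 else 0) +
        (if N * (1 / 24) ≤ (-1 : ℝ) * ((l.map d).count true - N * p) then 1 else 0) := by
        refine PMF.expectation_mono fun l hl => ?_
        have hlen := length_of_mem_support_independentDraws hl
        rw [List.length_replicate] at hlen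
        unfold reducedMean
        rw [List.length_map, hlen, div_le_iff₀ hNpos]
        by_cases hr : ((l.map d).count true : ℝ) ≤ (1 - 3 / 2 * (1 / 6)) * N
        · by_cases hp : p ≤ 5 / 6
          · rw [if_pos ⟨fun _ => hp, fun h => absurd hr h⟩]
            exact zero_le
          · rw [if_pos (c := N * (1 / 24) ≤ (-1 : ℝ) * _)]
            · split_ifs <;> simp
            · push Not at hp
              nlinarith
        · by_cases hp : 17 / 24 ≤ p
          · rw [if_pos ⟨fun h => absurd h hr, fun _ => hp⟩]
            exact zero_le
          · rw [if_pos (c := N * (1 / 24) ≤ (1 : ℝ) * _)]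
            · split_ifs <;> simp
            · push Not at hp hr
              nlinarith
    _ ≤ ENNReal.ofReal (δ / 2) + ENNReal.ofReal (δ / 2) := by
        rw [PMF.expectation_add]
        gcongr
        · exact (expectation_deviation_le h0 h1 hν (by norm_num) (by norm_num) (by simp) N).trans
            (ENNReal.ofReal_le_ofReal hexp)
        · exact (expectation_deviation_le h0 h1 hν (by norm_num) (by norm_num) (by simp) N).trans
            (ENNReal.ofReal_le_ofReal hexp)
    _ = _ := by rw [← ENNReal.ofReal_add (by positivity) (by positivity), add_halves]

/-! ### The choice of the sample size -/

/-- `t` is at most one step of the size grid above a size `s` whose mean `m s` is large. -/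
def NearGoodSize (m : ℕ → ℝ) (t : ℕ) : Prop :=
  ∃ s, 1 ≤ s ∧ s ≤ t ∧ 6 * t < 7 * (s + 1) ∧ 17 / 24 ≤ m s

/-- The witness in `NearGoodSize` is the last rejected size: it precedes an accepted size by one
grid step, and it is the chosen size itself when every test rejects. `last` carries the most
recently rejected size through the induction. -/
theorem chooseSize_spec {m : ℕ → ℝ} {e : ℝ} {ts : List ℕ} {bs : List (List Bool)}
    (h : List.Forall₂ (fun t b => (reducedMean e b → m t ≤ 5 / 6) ∧
      (¬ reducedMean e b → 17 / 24 ≤ m t)) ts bs) {last : ℕ}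
    (hchain : List.IsChain (fun a b => a ≤ b ∧ 6 * b < 7 * (a + 1)) (last :: ts))
    (h1 : 1 ≤ last) (hlast : 17 / 24 ≤ m last) :
    NearGoodSize m (chooseSize e last (ts.zip bs)) ∧
      (m (chooseSize e last (ts.zip bs)) ≤ 5 / 6 ∨
        chooseSize e last (ts.zip bs) = (last :: ts).getLast (by simp)) ∧
      chooseSize e last (ts.zip bs) ∈ last :: ts := by
  induction h generalizing last with
  | nil => exact ⟨⟨last, h1, le_rfl, by simp only [List.zip_nil_left, chooseSize]; omega, hlast⟩,
      Or.inr rfl, by simp [chooseSize]⟩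
  | @cons t b ts bs hb _ ih =>
    rw [List.isChain_cons_cons] at hchain
    obtain ⟨⟨hle, hlt⟩, hchain⟩ := hchain
    rw [List.zip_cons_cons, chooseSize]
    split_ifs with hr
    · exact ⟨⟨last, h1, hle, hlt, hlast⟩, Or.inl (hb.1 hr), by simp⟩
    · obtain ⟨i1, i2, i3⟩ := ih hchain (h1.trans hle) (hb.2 hr)
      exact ⟨i1, by simpa using i2, List.mem_cons_of_mem _ i3⟩

/-- The candidate sizes of Threshold-Sampling-For-Cover for `a` remaining elements. -/
noncomputable def sizeGrid (m a : ℕ) : List ℕ :=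
  (List.range (m + 1)).map fun i => min ⌊(1 + 1 / 6 : ℝ) ^ i⌋₊ a

theorem length_sizeGrid (m a : ℕ) : (sizeGrid m a).length = m + 1 := by simp [sizeGrid]

theorem mem_sizeGrid {m a t : ℕ} (ha : 1 ≤ a) (h : t ∈ sizeGrid m a) : 1 ≤ t ∧ t ≤ a := by
  simp only [sizeGrid, List.mem_map] at h
  obtain ⟨i, -, rfl⟩ := h
  refine ⟨le_min ?_ ha, min_le_right _ _⟩
  exact Nat.le_floor (by simpa using one_le_pow₀ (by norm_num : (1 : ℝ) ≤ 1 + 1 / 6))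

/-- One step multiplies the real size by 7/6; the summand 1 on the right absorbs the rounding down.
-/
theorem sizeGrid_step (a i : ℕ) :
    min ⌊(1 + 1 / 6 : ℝ) ^ i⌋₊ a ≤ min ⌊(1 + 1 / 6 : ℝ) ^ (i + 1)⌋₊ a ∧
      6 * min ⌊(1 + 1 / 6 : ℝ) ^ (i + 1)⌋₊ a < 7 * (min ⌊(1 + 1 / 6 : ℝ) ^ i⌋₊ a + 1) := by
  have hmono : ⌊(1 + 1 / 6 : ℝ) ^ i⌋₊ ≤ ⌊(1 + 1 / 6 : ℝ) ^ (i + 1)⌋₊ :=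
    Nat.floor_mono (pow_le_pow_right₀ (by norm_num) (Nat.le_succ i))
  have hstep : 6 * ⌊(1 + 1 / 6 : ℝ) ^ (i + 1)⌋₊ < 7 * (⌊(1 + 1 / 6 : ℝ) ^ i⌋₊ + 1) := by
    have h1 := Nat.floor_le (by positivity : 0 ≤ (1 + 1 / 6 : ℝ) ^ (i + 1))
    have h2 := Nat.lt_floor_add_one ((1 + 1 / 6 : ℝ) ^ i)
    rw [pow_succ] at h1
    rw [← Nat.cast_lt (α := ℝ)]
    push_cast
    rw [pow_succ]
    linarith
  omega

theorem isChain_sizeGrid_tail (m a : ℕ) :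
    ∃ l, sizeGrid m a = min 1 a :: l ∧
      List.IsChain (fun a b => a ≤ b ∧ 6 * b < 7 * (a + 1)) (min 1 a :: l) ∧
      (min 1 a :: l).getLast (by simp) = min ⌊(1 + 1 / 6 : ℝ) ^ m⌋₊ a := by
  have hc : List.IsChain (fun a b => a ≤ b ∧ 6 * b < 7 * (a + 1)) (sizeGrid m a) := by
    rw [sizeGrid, List.isChain_map]
    rw [List.isChain_iff_getElem]
    intro i hi
    simpa using sizeGrid_step a i
  have hne : sizeGrid m a ≠ [] := by simp [sizeGrid]
  have hl : (sizeGrid m a).getLast hne = min ⌊(1 + 1 / 6 : ℝ) ^ m⌋₊ a := by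
    simp [sizeGrid, List.getLast_map]
  have hd : sizeGrid m a = min 1 a :: (sizeGrid m a).tail := by
    conv_lhs => rw [← List.cons_head_tail hne]
    congr 1
    simp [sizeGrid, List.head_map]
  refine ⟨_, hd, hd ▸ hc, ?_⟩
  rw [← hl]
  congr 1
  exact hd.symm

end SubmodularCover

/-! ### Gains of monotone submodular functions -/

section Gains

variable {α : Type u} [DecidableEq α] {f : Finset α → ℤ}

theorem marginalGain_nonneg (hf : Monotone f) (T S : Finset α) : 0 ≤ marginalGain f T S :=
  sub_nonneg.2 (hf Finset.subset_union_left)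

/-- `IsSubmodular` speaks only of `x ∉ T`. For `x ∈ T` the gain over `T` is zero and monotonicity
suffices. -/
theorem marginalGain_singleton_antitone (hf : Monotone f) (hs : IsSubmodular f) {S T : Finset α}
    (h : S ⊆ T) (x : α) : marginalGain f {x} T ≤ marginalGain f {x} S := by
  by_cases hx : x ∈ T
  · have : T ∪ {x} = T := Finset.union_eq_left.2 (Finset.singleton_subset_iff.2 hx)
    have h0 : marginalGain f {x} T = 0 := by simp [marginalGain, this]
    rw [h0]
    exact marginalGain_nonneg hf _ _
  · exact hs S T h x hx

/-- The gain of a set is at most the sum of the gains of its elements. -/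
theorem marginalGain_le_sum (hf : Monotone f) (hs : IsSubmodular f) (S O : Finset α) :
    marginalGain f O S ≤ ∑ x ∈ O, marginalGain f {x} S := by
  induction O using Finset.induction_on with
  | empty => simp [marginalGain]
  | insert x O hx ih =>
    rw [Finset.sum_insert hx]
    have h := marginalGain_singleton_antitone hf hs (Finset.subset_union_left (s₁ := S) (s₂ := O)) x
    have e : S ∪ insert x O = (S ∪ O) ∪ {x} := by
      rw [Finset.union_assoc, Finset.union_comm O, Finset.insert_eq]
    unfold marginalGain at *
    rw [e]
    linarith

end Gains

theorem exists_optimal_cover {α : Type u} {f : Finset α → ℤ} {L : ℤ} {S₀ : Finset α}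
    (h : L ≤ f S₀) : ∃ O : Finset α, O.card = optCoverSize f L ∧ L ≤ f O :=
  Nat.sInf_mem (s := {k : ℕ | ∃ S : Finset α, S.card = k ∧ L ≤ f S}) ⟨S₀.card, S₀, rfl, h⟩

theorem one_le_optCoverSize {α : Type u} {f : Finset α → ℤ} {L : ℤ} {S₀ : Finset α}
    (h : L ≤ f S₀) (h0 : f ∅ < L) : 1 ≤ optCoverSize f L := by
  obtain ⟨O, h1, h2⟩ := exists_optimal_cover h
  rw [← h1, Nat.one_le_iff_ne_zero]
  intro h3
  rw [Finset.card_eq_zero.1 h3] at h2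
  omega

/-! ### Analysis of a single step: unresolved elements and the potential -/

namespace SubmodularCover

section Step

variable {α : Type u} [DecidableEq α] {f : Finset α → ℤ} {L : ℤ} {S : Finset α} {τ : ℝ}

/-- The gain that is missing to the target. -/
def gap (f : Finset α → ℤ) (L : ℤ) (S : Finset α) : ℝ := ((L - f S : ℤ) : ℝ)

theorem gap_union_le (hf : Monotone f) (S T : Finset α) : gap f L (S ∪ T) ≤ gap f L S := by
  have := hf (Finset.subset_union_left (s₁ := S) (s₂ := T))
  unfold gap
  exact_mod_cast (by omega)

theorem one_le_gap (h : f S < L) : 1 ≤ gap f L S := by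
  unfold gap
  exact_mod_cast (by omega)

theorem gap_nonpos_iff : gap f L S ≤ 0 ↔ L ≤ f S := by
  unfold gap
  rw [← Int.cast_zero, Int.cast_le]
  omega

/-- The gain of `x` after adding `T` to `S` reaches the threshold. -/
def IsGood (f : Finset α → ℤ) (τ : ℝ) (S T : Finset α) (x : α) : Prop :=
  τ ≤ ((marginalGain f {x} (S ∪ T) : ℤ) : ℝ)

theorem IsGood.anti (hf : Monotone f) (hs : IsSubmodular f) {T T' : Finset α} {x : α}
    (h : T ⊆ T') (hg : IsGood f τ S T' x) : IsGood f τ S T x :=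
  le_trans hg (Int.cast_le.2
    (marginalGain_singleton_antitone hf hs (Finset.union_subset_union_right h) x))

/-- A lower bound for the number of elements of `T` that were good when they were added. -/
noncomputable def gainCount (f : Finset α → ℤ) (τ : ℝ) (S T : Finset α) : ℕ :=
  min ⌊((marginalGain f T S : ℤ) : ℝ) / τ⌋₊ T.card

/-- A good element raises the gain by at least `τ`, so the floor goes up by at least one. Truncation
at the cardinality costs nothing, because that also grows by one; it serves to keep `gainCount`
below the size of `T` even when single gains exceed `τ`. -/
theorem gainCount_insert (hf : Monotone f) (hτ : 0 < τ) [∀ T x, Decidable (IsGood f τ S T x)]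
    {T : Finset α} {x : α} (hx : x ∉ T) :
    (gainCount f τ S T : ℝ) + (if IsGood f τ S T x then 1 else 0) ≤
      gainCount f τ S (insert x T) := by
  have e : S ∪ insert x T = S ∪ T ∪ {x} := by
    rw [Finset.union_assoc, Finset.union_comm T, Finset.insert_eq]
  have e1 : marginalGain f (insert x T) S = marginalGain f T S + marginalGain f {x} (S ∪ T) := by
    unfold marginalGain; rw [e]; ring
  have h0 : (0 : ℝ) ≤ ((marginalGain f T S : ℤ) : ℝ) / τ :=
    div_nonneg (by exact_mod_cast marginalGain_nonneg hf T S) hτ.le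
  have h1 : (0 : ℝ) ≤ ((marginalGain f {x} (S ∪ T) : ℤ) : ℝ) := by
    exact_mod_cast marginalGain_nonneg hf _ _
  unfold gainCount
  rw [Finset.card_insert_of_notMem hx, e1, Int.cast_add, add_div]
  split_ifs with h
  · have : ⌊((marginalGain f T S : ℤ) : ℝ) / τ⌋₊ + 1 ≤
        ⌊((marginalGain f T S : ℤ) : ℝ) / τ + ((marginalGain f {x} (S ∪ T) : ℤ) : ℝ) / τ⌋₊ := by
      rw [← Nat.floor_add_one h0]
      refine Nat.floor_mono ?_
      gcongr
      exact (one_le_div hτ).2 h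
    have : min ⌊((marginalGain f T S : ℤ) : ℝ) / τ⌋₊ T.card + 1 ≤
        min ⌊((marginalGain f T S : ℤ) : ℝ) / τ + ((marginalGain f {x} (S ∪ T) : ℤ) : ℝ) / τ⌋₊
          (T.card + 1) := by omega
    exact_mod_cast this
  · have : ⌊((marginalGain f T S : ℤ) : ℝ) / τ⌋₊ ≤
        ⌊((marginalGain f T S : ℤ) : ℝ) / τ + ((marginalGain f {x} (S ∪ T) : ℤ) : ℝ) / τ⌋₊ := by
      refine Nat.floor_mono (le_add_of_nonneg_right (by positivity))
    rw [add_zero, Nat.cast_le]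
    omega

theorem mul_gainCount_le (hf : Monotone f) (hτ : 0 < τ) (T : Finset α) :
    τ * gainCount f τ S T ≤ gap f L S - gap f L (S ∪ T) := by
  have h0 : (0 : ℝ) ≤ ((marginalGain f T S : ℤ) : ℝ) / τ :=
    div_nonneg (by exact_mod_cast marginalGain_nonneg hf T S) hτ.le
  have h1 : (gainCount f τ S T : ℝ) ≤ ((marginalGain f T S : ℤ) : ℝ) / τ :=
    le_trans (Nat.cast_le.2 (min_le_left _ _)) (Nat.floor_le h0)
  rw [le_div_iff₀ hτ] at h1
  have : gap f L S - gap f L (S ∪ T) = ((marginalGain f T S : ℤ) : ℝ) := by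
    unfold gap marginalGain; push_cast; ring
  linarith

/-- The cap on the number of elements that are added in one step. -/
noncomputable def stepCap (f : Finset α → ℤ) (L : ℤ) (τ : ℝ) (S : Finset α) : ℕ :=
  ⌊((L - f S : ℤ) : ℝ) / ((1 - 1 / 2) * τ)⌋₊

theorem stepCap_mul_le (hτ : 0 < τ) (h : 0 ≤ gap f L S) :
    (stepCap f L τ S : ℝ) * τ ≤ 2 * gap f L S := by
  have h2 : 0 < (1 - 1 / 2) * τ := by linarith
  have := Nat.floor_le (div_nonneg h h2.le)
  rw [le_div_iff₀ h2] at this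
  unfold stepCap
  unfold gap at *
  linarith

theorem lt_stepCap_succ_mul (hτ : 0 < τ) :
    2 * gap f L S < ((stepCap f L τ S : ℝ) + 1) * τ := by
  have h2 : 0 < (1 - 1 / 2) * τ := by linarith
  have := Nat.lt_floor_add_one (((L - f S : ℤ) : ℝ) / ((1 - 1 / 2) * τ))
  rw [div_lt_iff₀ h2] at this
  unfold stepCap gap
  linarith

variable [Fintype α]

/-- The elements whose gain reaches the threshold. -/
noncomputable def survivors (f : Finset α → ℤ) (τ : ℝ) (S : Finset α) : Finset α :=
  Finset.univ.filter fun x => τ ≤ ((marginalGain f {x} S : ℤ) : ℝ)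

theorem survivors_anti (hf : Monotone f) (hs : IsSubmodular f) {S S' : Finset α} (h : S ⊆ S') :
    survivors f τ S' ⊆ survivors f τ S := by
  intro x
  simp only [survivors, Finset.mem_filter, Finset.mem_univ, true_and]
  intro hx
  exact hx.trans (Int.cast_le.2 (marginalGain_singleton_antitone hf hs h x))

open Classical in
/-- The number of elements whose gain reaches the threshold, counted as `0` when less than half of
the threshold is missing to the target. -/
noncomputable def unresolved (f : Finset α → ℤ) (L : ℤ) (τ : ℝ) (S : Finset α) : ℕ :=
  if 2 * gap f L S < τ then 0 else (survivors f τ S).card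

theorem unresolved_le_card : unresolved f L τ S ≤ (survivors f τ S).card := by
  unfold unresolved
  split_ifs <;> simp

theorem unresolved_eq_zero_of_le (hτ : 0 < τ) (h : gap f L S ≤ 0) : unresolved f L τ S = 0 :=
  if_pos (by linarith)

/-- The probability that a sample of size `t` is good. -/
noncomputable def sampleMean (f : Finset α → ℤ) (τ : ℝ) (S : Finset α) (t : ℕ) : ℝ :=
  goodProb (survivors f τ S) (IsGood f τ S) (t - 1)

/-- With `T = ∅` every survivor is good. Hence a correct test never accepts size 1, and the chosen
size always has a rejected size to be compared with. -/
theorem sampleMean_one (h : (survivors f τ S).Nonempty) : sampleMean f τ S 1 = 1 := by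
  have hpos : (0 : ℝ) < (survivors f τ S).card := by exact_mod_cast h.card_pos
  have hx : ∀ x ∈ survivors f τ S, IsGood f τ S ∅ x := fun x hx => by
    simpa [survivors, IsGood] using hx
  have : goodCount (survivors f τ S) (IsGood f τ S) 0 = (survivors f τ S).card := by
    unfold goodCount
    rw [Finset.powersetCard_zero, Finset.sum_singleton, Finset.sdiff_empty,
      Finset.sum_congr rfl fun x h => if_pos (hx x h)]
    simp
  simp [sampleMean, goodProb, this, hpos.ne']

/-- The properties of a sample size that the analysis uses. -/
def IsGoodSize (f : Finset α → ℤ) (τ : ℝ) (S : Finset α) (t : ℕ) : Prop :=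
  1 ≤ t ∧ t ≤ (survivors f τ S).card ∧ NearGoodSize (sampleMean f τ S) t ∧
    (sampleMean f τ S t ≤ 5 / 6 ∨ t = (survivors f τ S).card)

/-- A sample of size `s` conditions on `s - 1` elements, so its mean is a lower bound for each of
the first `s` additions. -/
theorem le_subsetMean_gainCount (hf : Monotone f) (hs : IsSubmodular f) (hτ : 0 < τ) {s k : ℕ}
    (hs1 : 1 ≤ s) (hsa : s ≤ (survivors f τ S).card) (hk : k ≤ (survivors f τ S).card)
    (hm : 17 / 24 ≤ sampleMean f τ S s) :
    17 / 24 * (min k s : ℕ) ≤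
      subsetMean (survivors f τ S) k fun T => (gainCount f τ S T : ℝ) := by
  classical
  have h := min_mul_goodProb_le_subsetMean (A := survivors f τ S) (G := IsGood f τ S)
    (fun T T' x h _ hg => hg.anti hf hs h) (c := fun T => (gainCount f τ S T : ℝ))
    (by positivity) (fun T x hx => gainCount_insert hf hτ hx) (s := s - 1) (by omega) hk
  rw [Nat.sub_add_cancel hs1] at h
  refine le_trans ?_ h
  unfold sampleMean at hm
  rw [mul_comm]
  gcongr

/-- In expectation, a step with a good sample size shrinks the number of unresolved elements. -/
theorem subsetMean_unresolved_le (hf : Monotone f) (hs : IsSubmodular f) (hτ : 0 < τ) {t : ℕ}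
    (ht : IsGoodSize f τ S t) (hgap : τ ≤ 2 * gap f L S) :
    subsetMean (survivors f τ S) (min t (stepCap f L τ S))
      (fun T => (unresolved f L τ (S ∪ T) : ℝ)) ≤ 5 / 6 * (survivors f τ S).card := by
  classical
  obtain ⟨ht1, hta, ⟨s, hs1, hst, hts, hms⟩, hmt⟩ := ht
  set A := survivors f τ S with hA
  rcases le_or_gt t (stepCap f L τ S) with hcap | hcap
  · rw [min_eq_left hcap]
    obtain ⟨j, rfl⟩ : ∃ j, t = j + 1 := ⟨t - 1, by omega⟩
    -- Uncapped step. Elements of `T` have gain `0 < τ` over `S ∪ T`, so the new survivors are among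
    -- the good elements of `A \ T`.
    have h1 : subsetMean A (j + 1) (fun T => (unresolved f L τ (S ∪ T) : ℝ)) ≤
        goodCount A (IsGood f τ S) (j + 1) / (A.card.choose (j + 1) : ℝ) := by
      refine div_le_div_of_nonneg_right (Finset.sum_le_sum fun T _ => ?_) (by positivity)
      rw [Finset.sum_boole, Nat.cast_le]
      refine unresolved_le_card.trans (Finset.card_le_card fun x hx => ?_)
      have hxA := survivors_anti hf hs Finset.subset_union_left hx
      simp only [survivors, Finset.mem_filter, Finset.mem_univ, true_and] at hx
      refine Finset.mem_filter.2 ⟨Finset.mem_sdiff.2 ⟨hxA, fun hxT => ?_⟩, hx⟩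
      have : S ∪ T ∪ {x} = S ∪ T :=
        Finset.union_eq_left.2 (Finset.singleton_subset_iff.2 (Finset.mem_union_right _ hxT))
      rw [marginalGain, this, sub_self, Int.cast_zero] at hx
      linarith
    have h2 := goodCount_succ_div_le (A := A) (G := IsGood f τ S)
      (fun T T' x h _ hg => hg.anti hf hs h) (k := j) (by omega)
    have h3 : ((A.card : ℝ) - (j + 1)) * goodProb A (IsGood f τ S) j ≤ 5 / 6 * A.card := by
      have hj : ((j : ℝ) + 1) ≤ A.card := by exact_mod_cast hta
      rcases hmt with hmt | hmt
      · have hmt' : goodProb A (IsGood f τ S) j ≤ 5 / 6 := hmt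
        have := goodProb_nonneg (A := A) (IsGood f τ S) (k := j) (by omega)
        have : (0 : ℝ) ≤ j := by positivity
        nlinarith
      · have : (A.card : ℝ) = j + 1 := by exact_mod_cast hmt.symm
        rw [this, sub_self, zero_mul]
        positivity
    linarith
  · rw [min_eq_right hcap.le]
    set k := stepCap f L τ S with hk
    -- This is where `τ ≤ 2 * gap` is needed: for a smaller gap the cap is zero and the step would
    -- make no progress.
    have hk1 : 1 ≤ k := by
      have := lt_stepCap_succ_mul (f := f) (L := L) (S := S) hτ
      rw [← hk] at this
      by_contra h
      have h0 : k = 0 := by omega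
      rw [h0] at this
      push_cast at this
      linarith
    have hkpos : (0 : ℝ) < k := by exact_mod_cast hk1
    have hc := le_subsetMean_gainCount hf hs hτ (S := S) hs1
      (by rw [← hA]; omega) (k := k) (by rw [← hA]; omega) hms
    -- The strict inequality `k < t` turns `6 * t < 7 * (s + 1)` into `6 * k ≤ 7 * s`.
    have hmin : (6 / 7 * k : ℝ) ≤ (min k s : ℕ) := by
      have : 6 * k ≤ 7 * min k s := by omega
      have : (6 * k : ℝ) ≤ 7 * (min k s : ℕ) := by exact_mod_cast this
      linarith
    -- Markov's inequality in pointwise form. If `2 * gainCount ≥ k + 1`, the gain exceeds the gap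
    -- and nothing is unresolved; otherwise the factor multiplying `A.card` is at least 1. The mean
    -- of `k - gainCount` is at most `(1 - 17 / 24 * (6 / 7)) * k = 11 / 28 * k`, and `2 * (11 / 28)
    -- < 5 / 6`.
    have hpt : ∀ T ∈ A.powersetCard k, (unresolved f L τ (S ∪ T) : ℝ) ≤
        2 * A.card / k * (k - gainCount f τ S T) := by
      intro T hT
      have hTk : gainCount f τ S T ≤ k :=
        (min_le_right _ _).trans (Finset.mem_powersetCard.1 hT).2.le
      have hTk' : (gainCount f τ S T : ℝ) ≤ k := by exact_mod_cast hTk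
      rcases le_or_gt (k + 1) (2 * gainCount f τ S T) with h | h
      · have h1 := mul_gainCount_le (L := L) (S := S) hf hτ T
        have h2 := lt_stepCap_succ_mul (f := f) (L := L) (S := S) hτ
        have h3 : ((k : ℝ) + 1) ≤ 2 * gainCount f τ S T := by exact_mod_cast h
        rw [unresolved_eq_zero_of_le hτ (by nlinarith)]
        have : 0 ≤ (k : ℝ) - gainCount f τ S T := by linarith
        rw [Nat.cast_zero]; positivity
      · have h1 : (unresolved f L τ (S ∪ T) : ℝ) ≤ A.card := by
          exact_mod_cast unresolved_le_card.trans
            (Finset.card_le_card (survivors_anti hf hs Finset.subset_union_left))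
        refine h1.trans ?_
        rw [div_mul_eq_mul_div, le_div_iff₀ hkpos]
        have h3 : 2 * (gainCount f τ S T : ℝ) ≤ k := by exact_mod_cast (by omega)
        have : (0 : ℝ) ≤ A.card := by positivity
        nlinarith
    refine (subsetMean_mono hpt).trans ?_
    rw [subsetMean_const_mul, subsetMean_sub, subsetMean_const (by omega), div_mul_eq_mul_div,
      div_le_iff₀ hkpos]
    have hApos : (0 : ℝ) ≤ A.card := by positivity
    have : (k : ℝ) - subsetMean A k (fun T => (gainCount f τ S T : ℝ)) ≤ 11 / 28 * k := by linarith
    nlinarith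

/-- The potential that pays for the elements of the solution. -/
noncomputable def potential (f : Finset α → ℤ) (L : ℤ) (S : Finset α) : ℝ :=
  if L ≤ f S then 0 else 1 + Real.log (gap f L S)

theorem one_le_potential (h : f S < L) : 1 ≤ potential f L S := by
  rw [potential, if_neg (by omega)]
  have := Real.log_nonneg (one_le_gap h)
  linarith

theorem potential_nonneg : 0 ≤ potential f L S := by
  by_cases h : L ≤ f S
  · rw [potential, if_pos h]
  · linarith [one_le_potential (not_le.1 h)]

/-- Below the target this is `log x ≤ x - 1` for the ratio of the gaps. A step that reaches the
target is paid for by the summand 1 of the potential, which is why `d ≤ gap f L S` is required. -/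
theorem potential_add_le (h : f S < L) (T : Finset α) {d : ℝ}
    (hd : d ≤ gap f L S) (hd' : d ≤ gap f L S - gap f L (S ∪ T)) :
    potential f L (S ∪ T) + d / gap f L S ≤ potential f L S := by
  have hg := one_le_gap h
  have hg0 : 0 < gap f L S := by linarith
  by_cases h' : L ≤ f (S ∪ T)
  · have := one_le_potential h
    have h2 : d / gap f L S ≤ 1 := (div_le_one hg0).2 hd
    rw [potential, if_pos h']
    linarith
  · have hg' := one_le_gap (not_le.1 h')
    rw [potential, if_neg h', potential, if_neg (not_le.2 h)]
    have h1 := Real.log_le_sub_one_of_pos (div_pos (by linarith : 0 < gap f L (S ∪ T)) hg0)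
    rw [Real.log_div (by linarith) hg0.ne'] at h1
    have h2 : d / gap f L S ≤ 1 - gap f L (S ∪ T) / gap f L S := by
      rw [one_sub_div hg0.ne']
      gcongr
    linarith

theorem potential_union_le (hf : Monotone f) (h : f S < L) (T : Finset α) :
    potential f L (S ∪ T) ≤ potential f L S := by
  have hg := one_le_gap h
  have := potential_add_le h T (d := 0) (by linarith) (by linarith [gap_union_le (L := L) hf S T])
  simpa using this

/-- In expectation, the potential pays for the elements added in a step with a good sample size. -/
theorem add_subsetMean_potential_le (hf : Monotone f) (hs : IsSubmodular f) (hτ : 0 < τ) {t : ℕ}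
    (ht : IsGoodSize f τ S t) (hS : f S < L) {K : ℝ} (hK : 1 ≤ K)
    (hgap : gap f L S ≤ 2 * τ * K ∨ gap f L S < τ) :
    (min t (stepCap f L τ S) : ℕ) + 14 * K * subsetMean (survivors f τ S)
      (min t (stepCap f L τ S)) (fun T => potential f L (S ∪ T)) ≤ 14 * K * potential f L S := by
  obtain ⟨ht1, hta, ⟨s, hs1, hst, hts, hms⟩, -⟩ := ht
  set A := survivors f τ S with hA
  have hg1 := one_le_gap hS
  have hg0 : 0 < gap f L S := by linarith
  have hcap := stepCap_mul_le hτ hg0.le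
  have hpos := potential_nonneg (f := f) (L := L) (S := S)
  set k := min t (stepCap f L τ S) with hk
  have hka : k ≤ A.card := (min_le_left _ _).trans hta
  have hkcap : (k : ℝ) * τ ≤ 2 * gap f L S := by
    refine le_trans ?_ hcap
    gcongr
    exact min_le_right _ _
  rcases hgap with hgap | hgap
  · have hc := le_subsetMean_gainCount hf hs hτ (S := S) hs1
      (by rw [← hA]; omega) (k := k) hka hms
    -- Here `k = t` is possible, so `6 * t < 7 * (s + 1)` is combined with `s ≥ 1`.
    have hmin : (6 / 13 * k : ℝ) ≤ (min k s : ℕ) := by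
      have : 6 * k ≤ 13 * min k s := by omega
      have : (6 * k : ℝ) ≤ 13 * (min k s : ℕ) := by exact_mod_cast this
      linarith
    have hpt : ∀ T ∈ A.powersetCard k, potential f L (S ∪ T) ≤
        potential f L S - τ / 2 / gap f L S * gainCount f τ S T := by
      intro T hT
      have hTk : (gainCount f τ S T : ℝ) ≤ k := by
        exact_mod_cast (min_le_right _ _).trans (Finset.mem_powersetCard.1 hT).2.le
      have h1 := mul_gainCount_le (L := L) (S := S) hf hτ T
      have h0 : (0 : ℝ) ≤ gainCount f τ S T := by positivity
      -- Half of the guaranteed gain is used because the cap only ensures `k * τ ≤ 2 * gap`, while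
      -- `d` must not exceed the gap.
      have := potential_add_le hS T (d := τ / 2 * gainCount f τ S T) (by nlinarith)
        (by nlinarith)
      rw [div_mul_eq_mul_div]
      linarith
    have h1 := subsetMean_mono hpt
    rw [subsetMean_sub, subsetMean_const hka, subsetMean_const_mul] at h1
    have h2 : (17 / 52 * k : ℝ) ≤ subsetMean A k (fun T => (gainCount f τ S T : ℝ)) := by linarith
    -- With `gap ≤ 2 * τ * K` the constant 14 suffices: `7 / 2 * (17 / 52) > 1`.
    have h3 : (k : ℝ) ≤ 14 * K * (τ / 2 / gap f L S * (17 / 52 * k)) := by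
      have : 14 * K * (τ / 2 / gap f L S * (17 / 52 * k)) =
          (2 * τ * K) * (7 / 2 * (17 / 52) * k) / gap f L S := by
        field_simp; ring
      rw [this, le_div_iff₀ hg0]
      have : (0 : ℝ) ≤ k := by positivity
      nlinarith
    have h4 : τ / 2 / gap f L S * (17 / 52 * k) ≤
        τ / 2 / gap f L S * subsetMean A k (fun T => (gainCount f τ S T : ℝ)) := by gcongr
    nlinarith
  -- When the gap is below `τ`, the cap allows at most one element; such a survivor reaches the
  -- target alone, and the potential drops from at least 1 to 0.
  · have hk2 : k ≤ 1 := by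
      by_contra h
      have : (2 : ℝ) ≤ k := by exact_mod_cast (by omega)
      nlinarith
    interval_cases hk' : k
    · have : subsetMean A 0 (fun T => potential f L (S ∪ T)) = potential f L S := by
        simp [subsetMean]
      rw [this]; simp
    · have hpt : ∀ T ∈ A.powersetCard 1, potential f L (S ∪ T) ≤ 0 := by
        intro T hT
        obtain ⟨hTA, hT1⟩ := Finset.mem_powersetCard.1 hT
        obtain ⟨x, rfl⟩ := Finset.card_eq_one.1 hT1
        have hx := hTA (Finset.mem_singleton_self x)
        simp only [hA, survivors, Finset.mem_filter, Finset.mem_univ, true_and] at hx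
        have : gap f L S - gap f L (S ∪ {x}) = ((marginalGain f {x} S : ℤ) : ℝ) := by
          unfold gap marginalGain; push_cast; ring
        rw [potential, if_pos (gap_nonpos_iff.1 (by linarith))]
      have h1 := subsetMean_mono hpt
      rw [subsetMean_const hka] at h1
      have h2 := one_le_potential hS
      push_cast
      nlinarith

end Step

end SubmodularCover

namespace SubmodularCover

open AdaptiveAlg

section Loop

variable {α : Type u} [DecidableEq α] {f : Finset α → ℤ} {L : ℤ} {S : Finset α} {τ : ℝ}

/-! ### Cost of the loops -/

theorem length_flatten_of_mem_support {β : Type u} {ι : Type*} {D : ι → PMF β} {N : ℕ}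
    {ts : List ι} {samples : List (List β)}
    (h : samples ∈ (independentDraws
      (ts.map fun t => independentDraws (List.replicate N (D t)))).support) :
    samples.flatten.length = ts.length * N := by
  have h' := forall₂_of_mem_support_independentDraws h
  rw [List.forall₂_map_left_iff] at h'
  clear h
  induction h' with
  | nil => simp
  | cons hb _ ih =>
    have := length_of_mem_support_independentDraws hb
    rw [List.length_replicate] at this
    rw [List.flatten_cons, List.length_append, ih, this, List.length_cons]
    ring

theorem costAtMost_thresholdLoop (f : Finset α → ℤ) (L : ℤ) (τ ε εh δh : ℝ) (m : ℕ) {n q : ℕ}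
    (hq : n + 1 ≤ q) (hq' : 2 * ((m + 1) * numSamples εh δh) ≤ q) (r : ℕ) (S : Finset α)
    {A : Finset α} (hA : A.card ≤ n) :
    CostAtMost f (3 * r) q (thresholdLoop L τ ε εh δh m r S A) := by
  induction r generalizing S A with
  | zero => exact costAtMost_ret _ _ _ _
  | succ r ih =>
    rw [thresholdLoop, show 3 * (r + 1) = 3 * r + 1 + 1 + 1 by ring]
    refine costAtMost_query ?_ ?_
    · refine (Finset.card_insert_le _ _).trans ((Nat.succ_le_succ Finset.card_image_le).trans ?_)
      omega
    · dsimp only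
      rw [if_pos (Finset.mem_insert_self S _)]
      split_ifs
      · exact costAtMost_ret _ _ _ _
      refine costAtMost_draw fun samples hsamples => costAtMost_query ?_ ?_
      · refine Finset.card_biUnion_le.trans ?_
        refine (Finset.sum_le_card_nsmul _ _ 2 fun p _ => Finset.card_le_two).trans ?_
        have h1 := length_flatten_of_mem_support hsamples
        rw [List.length_map, List.length_range] at h1
        have h2 := List.toFinset_card_le samples.flatten
        rw [smul_eq_mul]
        omega
      refine costAtMost_draw fun T _ => costAtMost_query (by rw [Finset.card_singleton]; omega) ?_
      dsimp only
      -- The oracle's answer on `{S ∪ T}` is itself an `if`, hence four branches instead of two.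
      split_ifs
      · exact costAtMost_ret _ _ _ _
      · exact ih _ ((Finset.card_filter_le _ _).trans hA)
      · exact costAtMost_ret _ _ _ _
      · exact ih _ ((Finset.card_filter_le _ _).trans hA)

/-! ### The sample size is good with high probability -/

/-- The samples drawn in one iteration of the loop. -/
noncomputable def drawSamples (δh : ℝ) (m : ℕ) (A : Finset α) :
    PMF (List (List (Finset α × Finset α))) :=
  independentDraws ((sizeGrid m A.card).map fun t =>
    independentDraws (List.replicate (numSamples (1 / 6) δh) (sampleD A t)))

/-- The sample size chosen in one iteration of the loop. -/
noncomputable def chosenSize (f : Finset α → ℤ) (τ : ℝ) (m : ℕ) (S A : Finset α)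
    (samples : List (List (Finset α × Finset α))) : ℕ :=
  chooseSize (1 / 6) 0 ((sizeGrid m A.card).zip (samples.map fun l =>
    l.map fun p => decide (τ ≤ ((marginalGain f p.2 (S ∪ p.1) : ℤ) : ℝ))))

variable [Fintype α]

-- If all tests are right, size 1 is rejected, and the grid ends exactly at the number of survivors
-- because `(7 / 6) ^ m` is at least that large. So `chooseSize_spec` yields a good size, and the
-- failure probability is a union bound over `m + 1` tests.
open Classical in
theorem expectation_not_isGoodSize_le {δh : ℝ} {m : ℕ} (hne : (survivors f τ S).Nonempty)
    (hm : ((survivors f τ S).card : ℝ) ≤ (1 + 1 / 6) ^ m) (hδ0 : 0 < δh) (hδ1 : δh ≤ 1) :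
    ((drawSamples δh m (survivors f τ S)).expectation fun samples =>
      if IsGoodSize f τ S (chosenSize f τ m S (survivors f τ S) samples) then 0 else 1) ≤
      ENNReal.ofReal ((m + 1) * δh) := by
  set A := survivors f τ S with hA
  set d : Finset α × Finset α → Bool :=
    fun p => decide (τ ≤ ((marginalGain f p.2 (S ∪ p.1) : ℤ) : ℝ)) with hd
  obtain ⟨ok, hok⟩ : ∃ ok : ℕ → List (Finset α × Finset α) → Prop, ∀ t l, ok t l ↔
    (reducedMean (1 / 6) (l.map d) → sampleMean f τ S t ≤ 5 / 6) ∧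
      (¬ reducedMean (1 / 6) (l.map d) → 17 / 24 ≤ sampleMean f τ S t) :=
    ⟨_, fun _ _ => Iff.rfl⟩
  have hcard : 1 ≤ A.card := hne.card_pos
  have key : ∀ samples, List.Forall₂ ok (sizeGrid m A.card) samples →
      IsGoodSize f τ S (chosenSize f τ m S A samples) := by
    intro samples h
    obtain ⟨l, hl, hchain, hlast⟩ := isChain_sizeGrid_tail m A.card
    have hmem : ∀ t ∈ 1 :: l, 1 ≤ t ∧ t ≤ A.card := by
      intro t ht
      refine mem_sizeGrid (m := m) hcard ?_
      rw [hl, min_eq_left hcard]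
      exact ht
    rw [min_eq_left hcard] at hl
    simp only [min_eq_left hcard] at hchain hlast
    rw [min_eq_right (Nat.le_floor hm)] at hlast
    unfold chosenSize
    rw [hl] at h ⊢
    obtain ⟨b, bs, hb, hbs, rfl⟩ := List.forall₂_cons_left_iff.1 h
    have h1 : sampleMean f τ S 1 = 1 := sampleMean_one hne
    have hr : ¬ reducedMean (1 / 6) (b.map d) := fun hr => by
      have := ((hok _ _).1 hb).1 hr
      rw [h1] at this
      norm_num at this
    rw [List.map_cons, List.zip_cons_cons, chooseSize, if_neg hr]
    obtain ⟨i1, i2, i3⟩ := chooseSize_spec (m := sampleMean f τ S) (e := 1 / 6) (ts := l)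
      (bs := bs.map fun l => l.map d) (List.forall₂_map_right_iff.2 (hbs.imp fun t l h => (hok t l).1 h)) hchain le_rfl
      (by rw [h1]; norm_num)
    refine ⟨(hmem _ i3).1, (hmem _ i3).2, i1, i2.imp_right fun h => h.trans hlast⟩
  calc _ ≤ (drawSamples δh m A).expectation fun samples =>
        if List.Forall₂ ok (sizeGrid m A.card) samples then 0 else 1 := by
        refine PMF.expectation_mono fun samples _ => ?_
        by_cases h : List.Forall₂ ok (sizeGrid m A.card) samples
        · rw [if_pos (key _ h)]; exact zero_le
        · rw [if_neg h]; split_ifs <;> simp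
    _ ≤ (sizeGrid m A.card).length * ENNReal.ofReal δh := by
        refine expectation_not_forall₂_le fun t ht => ?_
        obtain ⟨ht1, ht2⟩ := mem_sizeGrid hcard ht
        obtain ⟨k, rfl⟩ : ∃ k, t = k + 1 := ⟨t - 1, by omega⟩
        have hk : k < A.card := by omega
        refine (PMF.expectation_congr fun l _ => if_congr (hok _ l) rfl rfl).trans_le ?_
        refine expectation_reducedMean_fails_le (d := d) (goodProb_nonneg _ hk)
          (goodProb_le_one _ hk) ?_ hδ0 hδ1
        have := expectation_sampleD hk
          (fun T X : Finset α => τ ≤ ((marginalGain f X (S ∪ T) : ℤ) : ℝ))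
        simp only [hd, decide_eq_true_eq]
        exact this
    _ = _ := by
        rw [length_sizeGrid, ENNReal.ofReal_mul (by positivity)]
        congr 1
        rw [← Nat.cast_succ, ENNReal.ofReal_natCast]

/-! ### One iteration of the loop -/

/-- The program sees only restrictions of `f` to its batches, but each batch contains every set
whose value is read afterwards. Discarded elements never become survivors again, so filtering `A`
gives the same set as filtering the whole ground set. -/
theorem expect_thresholdLoop_succ (φ : Finset α → ℝ≥0∞) (δh : ℝ) (m r : ℕ) {A : Finset α}
    (hA : survivors f τ S ⊆ A) :
    expect f φ (thresholdLoop L τ (1 / 2) (1 / 6) δh m (r + 1) S A) =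
      if survivors f τ S = ∅ then φ S else
        (drawSamples δh m (survivors f τ S)).expectation fun samples =>
          (uniformSubset (survivors f τ S) (min (chosenSize f τ m S (survivors f τ S) samples)
            (stepCap f L τ S))).expectation fun T =>
            if L ≤ f (S ∪ T) then φ (S ∪ T) else
              expect f φ (thresholdLoop L τ (1 / 2) (1 / 6) δh m r (S ∪ T) (survivors f τ S)) := by
  set Q := insert S (A.image fun x => S ∪ {x}) with hQ
  have hv : (if S ∈ Q then f S else 0) = f S := if_pos (Finset.mem_insert_self _ _)
  have hA' : (A.filter fun x =>
      τ ≤ ((marginalGain (fun S' => if S' ∈ Q then f S' else 0) {x} S : ℤ) : ℝ)) =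
      survivors f τ S := by
    ext x
    simp only [survivors, Finset.mem_filter, Finset.mem_univ, true_and]
    have hx : x ∈ A → marginalGain (fun S' => if S' ∈ Q then f S' else 0) {x} S =
        marginalGain f {x} S := fun hx => by
      have : S ∪ {x} ∈ Q := Finset.mem_insert_of_mem (Finset.mem_image_of_mem _ hx)
      simp only [marginalGain, hv, if_pos this]
    constructor
    · rintro ⟨h1, h2⟩
      rwa [hx h1] at h2
    · intro h
      have h1 : x ∈ A := hA (by simpa [survivors] using h)
      exact ⟨h1, by rwa [hx h1]⟩
  rw [thresholdLoop]
  simp only [expect]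
  rw [hA', hv]
  split_ifs with hE
  · rfl
  simp only [expect]
  refine PMF.expectation_congr fun samples _ => ?_
  set Q' := samples.flatten.toFinset.biUnion fun p : Finset α × Finset α =>
    {S ∪ p.1, S ∪ p.1 ∪ p.2} with hQ'
  have hw : (samples.map fun l => l.map fun p => decide (τ ≤ ((marginalGain
      (fun S' => if S' ∈ Q' then f S' else 0) p.2 (S ∪ p.1) : ℤ) : ℝ))) =
      samples.map fun l => l.map fun p =>
        decide (τ ≤ ((marginalGain f p.2 (S ∪ p.1) : ℤ) : ℝ)) := by
    refine List.map_congr_left fun l hl => List.map_congr_left fun p hp => ?_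
    have hp' : p ∈ samples.flatten.toFinset :=
      List.mem_toFinset.2 (List.mem_flatten.2 ⟨l, hl, hp⟩)
    have h1 : S ∪ p.1 ∈ Q' := Finset.mem_biUnion.2 ⟨p, hp', by simp⟩
    have h2 : S ∪ p.1 ∪ p.2 ∈ Q' := Finset.mem_biUnion.2 ⟨p, hp', by simp⟩
    have e : marginalGain (fun S' => if S' ∈ Q' then f S' else 0) p.2 (S ∪ p.1) =
        marginalGain f p.2 (S ∪ p.1) := by simp only [marginalGain, if_pos h1, if_pos h2]
    rw [e]
  rw [hw]
  refine PMF.expectation_congr fun T _ => ?_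
  simp only [Finset.mem_singleton_self, if_true]
  split_ifs <;> rfl

/-- The probability that the loop ends with an unresolved element. -/
theorem expect_thresholdLoop_unresolved_le (hf : Monotone f) (hs : IsSubmodular f) (hτ : 0 < τ)
    {δh : ℝ} {m : ℕ} (hm : (Fintype.card α : ℝ) ≤ (1 + 1 / 6) ^ m) (hδ0 : 0 < δh) (hδ1 : δh ≤ 1)
    (r : ℕ) (S : Finset α) {A : Finset α} (hA : survivors f τ S ⊆ A) :
    expect f (fun S' => if unresolved f L τ S' = 0 then 0 else 1)
      (thresholdLoop L τ (1 / 2) (1 / 6) δh m r S A) ≤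
      ENNReal.ofReal ((5 / 6) ^ r * unresolved f L τ S + r * ((m + 1) * δh)) := by
  classical
  set φ : Finset α → ℝ≥0∞ := fun S' => if unresolved f L τ S' = 0 then 0 else 1 with hφ
  have hφ1 : ∀ S', φ S' ≤ 1 := fun S' => by simp only [hφ]; split_ifs <;> simp
  have hη : 0 ≤ (m + 1) * δh := by positivity
  induction r generalizing S A with
  | zero =>
    simp only [thresholdLoop, expect, hφ]
    split_ifs with h
    · exact zero_le
    · rw [← ENNReal.ofReal_one]
      refine ENNReal.ofReal_le_ofReal ?_
      have : (1 : ℝ) ≤ unresolved f L τ S := by exact_mod_cast Nat.one_le_iff_ne_zero.2 h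
      simpa using this
  | succ r ih =>
    rw [expect_thresholdLoop_succ φ δh m r hA]
    split_ifs with hE
    · have : unresolved f L τ S = 0 := by
        have := unresolved_le_card (f := f) (L := L) (τ := τ) (S := S)
        rw [hE, Finset.card_empty] at this
        omega
      simp [hφ, this]
    have hstep : ∀ T, (if L ≤ f (S ∪ T) then φ (S ∪ T) else
        expect f φ (thresholdLoop L τ (1 / 2) (1 / 6) δh m r (S ∪ T) (survivors f τ S))) ≤
        ENNReal.ofReal ((5 / 6) ^ r * unresolved f L τ (S ∪ T) + r * ((m + 1) * δh)) := by
      intro T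
      split_ifs with h
      · simp [hφ, unresolved_eq_zero_of_le hτ (gap_nonpos_iff.2 h)]
      · exact ih _ (survivors_anti hf hs Finset.subset_union_left)
    have hne := Finset.nonempty_iff_ne_empty.2 hE
    -- A gap below `τ / 2` stays so, since gaps only shrink; both sides then count no unresolved
    -- element.
    rcases lt_or_ge (2 * gap f L S) τ with hg | hg
    · refine PMF.expectation_le_const fun samples _ => PMF.expectation_le_const fun T _ => ?_
      refine (hstep T).trans (ENNReal.ofReal_le_ofReal ?_)
      have h0 : unresolved f L τ (S ∪ T) = 0 :=
        if_pos (by linarith [gap_union_le (L := L) hf S T])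
      rw [h0, unresolved, if_pos hg]
      push_cast
      linarith
    · have hres : unresolved f L τ S = (survivors f τ S).card := if_neg (not_lt.2 hg)
      have hcard : ((survivors f τ S).card : ℝ) ≤ (1 + 1 / 6) ^ m :=
        le_trans (by exact_mod_cast Finset.card_le_univ _) hm
      refine (PMF.expectation_le_add_mul _
        (fun samples => IsGoodSize f τ S (chosenSize f τ m S (survivors f τ S) samples))
        (a := ENNReal.ofReal ((5 / 6) ^ r * (5 / 6 * (survivors f τ S).card) +
          r * ((m + 1) * δh))) (b := 1) ?_ ?_
        (expectation_not_isGoodSize_le hne hcard hδ0 hδ1)).trans ?_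
      · intro samples _ hgood
        have hk : min (chosenSize f τ m S (survivors f τ S) samples) (stepCap f L τ S) ≤
            (survivors f τ S).card := (min_le_left _ _).trans hgood.2.1
        refine (PMF.expectation_mono fun T _ => hstep T).trans ?_
        rw [expectation_uniformSubset hk fun T _ => by positivity, subsetMean_add,
          subsetMean_const_mul, subsetMean_const hk]
        refine ENNReal.ofReal_le_ofReal ?_
        gcongr
        exact subsetMean_unresolved_le hf hs hτ hgood hg
      · intro samples _
        refine PMF.expectation_le_const fun T _ => le_trans ?_ le_add_self
        split_ifs
        · exact hφ1 _
        · exact expect_le_const hφ1 _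
      · rw [one_mul, ← ENNReal.ofReal_add (by positivity) hη, hres]
        refine ENNReal.ofReal_le_ofReal (le_of_eq ?_)
        push_cast
        ring

/-- The expected size of the result of the loop, up to the potential. -/
theorem expect_thresholdLoop_card_le (hf : Monotone f) (hs : IsSubmodular f) (hτ : 0 < τ)
    {δh : ℝ} {m : ℕ} (hm : (Fintype.card α : ℝ) ≤ (1 + 1 / 6) ^ m) (hδ0 : 0 < δh) (hδ1 : δh ≤ 1)
    {K : ℝ} (hK : 1 ≤ K) (r : ℕ) {S : Finset α} (hS : f S < L)
    (hgap : gap f L S ≤ 2 * τ * K ∨ gap f L S < τ) {A : Finset α} (hA : survivors f τ S ⊆ A) :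
    expect f (fun S' => ENNReal.ofReal (S'.card + 14 * K * potential f L S'))
      (thresholdLoop L τ (1 / 2) (1 / 6) δh m r S A) ≤
      ENNReal.ofReal (S.card + 14 * K * potential f L S +
        Fintype.card α * (r * ((m + 1) * δh))) := by
  classical
  set n : ℝ := (Fintype.card α : ℝ) with hn
  have hn0 : 0 ≤ n := by positivity
  set φ : Finset α → ℝ≥0∞ := fun S' =>
    ENNReal.ofReal (S'.card + 14 * K * potential f L S') with hφ
  have hη : 0 ≤ (m + 1) * δh := by positivity
  have hpot : ∀ S', 0 ≤ potential f L S' := fun S' => potential_nonneg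
  have hK0 : 0 ≤ 14 * K := by linarith
  have hsum : ∀ S' : Finset α, 0 ≤ (S'.card : ℝ) + 14 * K * potential f L S' := fun S' =>
    add_nonneg (by positivity) (mul_nonneg hK0 (hpot S'))
  induction r generalizing S A with
  | zero =>
    simp [thresholdLoop, expect, hφ]
  | succ r ih =>
    have hrη : 0 ≤ n * (r * ((m + 1) * δh)) := by positivity
    rw [expect_thresholdLoop_succ φ δh m r hA]
    split_ifs with hE
    · exact ENNReal.ofReal_le_ofReal (le_add_of_nonneg_right (by positivity))
    have hstep : ∀ T, (if L ≤ f (S ∪ T) then φ (S ∪ T) else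
        expect f φ (thresholdLoop L τ (1 / 2) (1 / 6) δh m r (S ∪ T) (survivors f τ S))) ≤
        ENNReal.ofReal (S.card + T.card + n * (r * ((m + 1) * δh)) +
          14 * K * potential f L (S ∪ T)) := by
      intro T
      have hcard : ((S ∪ T).card : ℝ) ≤ S.card + T.card := by
        exact_mod_cast Finset.card_union_le S T
      split_ifs with h
      · exact ENNReal.ofReal_le_ofReal (by linarith)
      · have hle := gap_union_le (L := L) hf S T
        refine (ih (not_le.1 h) (hgap.imp hle.trans hle.trans_lt)
          (survivors_anti hf hs Finset.subset_union_left)).trans (ENNReal.ofReal_le_ofReal ?_)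
        linarith
    have hne := Finset.nonempty_iff_ne_empty.2 hE
    have hcard : ((survivors f τ S).card : ℝ) ≤ (1 + 1 / 6) ^ m :=
      le_trans (Nat.cast_le.2 (Finset.card_le_univ _)) hm
    -- A bad sample size adds at most `n` elements and cannot raise the potential, so its cost is
    -- `n` times its probability.
    refine (PMF.expectation_le_add_mul _
      (fun samples => IsGoodSize f τ S (chosenSize f τ m S (survivors f τ S) samples))
      (a := ENNReal.ofReal (S.card + 14 * K * potential f L S + n * (r * ((m + 1) * δh))))
      (b := ENNReal.ofReal n) ?_ ?_ (expectation_not_isGoodSize_le hne hcard hδ0 hδ1)).trans ?_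
    · intro samples _ hgood
      have hk : min (chosenSize f τ m S (survivors f τ S) samples) (stepCap f L τ S) ≤
          (survivors f τ S).card := (min_le_left _ _).trans hgood.2.1
      have hmain := add_subsetMean_potential_le hf hs hτ hgood hS hK hgap
      set k := min (chosenSize f τ m S (survivors f τ S) samples) (stepCap f L τ S) with hkdef
      calc _ ≤ (uniformSubset (survivors f τ S) k).expectation fun T =>
            ENNReal.ofReal ((S.card + k + n * (r * ((m + 1) * δh))) +
              14 * K * potential f L (S ∪ T)) := by
            refine PMF.expectation_mono fun T hT => (hstep T).trans ?_
            rw [((mem_support_uniformSubset hk).1 hT).2]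
        _ ≤ _ := by
            rw [expectation_uniformSubset hk fun T _ => add_nonneg (by positivity)
              (mul_nonneg hK0 (hpot _)), subsetMean_add, subsetMean_const_mul,
              subsetMean_const hk]
            refine ENNReal.ofReal_le_ofReal ?_
            linarith
    · intro samples _
      rw [← ENNReal.ofReal_add (add_nonneg (hsum S) hrη) hn0]
      refine PMF.expectation_le_const fun T _ => (hstep T).trans (ENNReal.ofReal_le_ofReal ?_)
      have h1 : (T.card : ℝ) ≤ n := Nat.cast_le.2 (Finset.card_le_univ T)
      have h2 := mul_le_mul_of_nonneg_left (potential_union_le hf hS T) hK0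
      linarith
    · rw [← ENNReal.ofReal_mul hn0, ← ENNReal.ofReal_add (add_nonneg (hsum S) hrη) (by positivity)]
      refine ENNReal.ofReal_le_ofReal (le_of_eq ?_)
      push_cast
      ring

end Loop

end SubmodularCover

namespace SubmodularCover

open AdaptiveAlg

/-! ### Parameters of the subroutine -/

/-- The number of iterations in Threshold-Sampling-For-Cover. -/
noncomputable def numIterations (n δ : ℝ) : ℕ := ⌈Real.logb (1 - 1 / 6)⁻¹ (2 * n / δ)⌉₊

/-- The exponent of the largest candidate size. -/
noncomputable def gridExponent (n : ℝ) : ℕ := ⌈Real.logb (1 + 1 / 6) n⌉₊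

/-- The failure probability passed to Reduced-Mean. -/
noncomputable def sampleFailure (n δ : ℝ) : ℝ :=
  δ / (2 * numIterations n δ * (gridExponent n + 1))

theorem le_pow_gridExponent {n : ℝ} (hn : 0 < n) : n ≤ (1 + 1 / 6) ^ gridExponent n := by
  rw [← Real.rpow_natCast, ← Real.logb_le_iff_le_rpow (by norm_num) hn]
  exact Nat.le_ceil _

theorem one_le_numIterations {n δ : ℝ} (hn : 2 ≤ n) (hδ0 : 0 < δ) (hδ1 : δ ≤ 1) :
    1 ≤ numIterations n δ := by
  refine Nat.one_le_iff_ne_zero.2 (Nat.pos_iff_ne_zero.1 (Nat.ceil_pos.2 ?_))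
  refine Real.logb_pos (by norm_num) ?_
  rw [lt_div_iff₀ hδ0]
  linarith

/-- Half of the failure budget goes to unresolved elements that outlast all iterations;
`numIterations_mul_sampleFailure` spends the other half on wrong tests. -/
theorem pow_numIterations_mul_le {n δ : ℝ} (hn : 0 < n) (hδ0 : 0 < δ) :
    (5 / 6) ^ numIterations n δ * n ≤ δ / 2 := by
  have h : 2 * n / δ ≤ ((1 - 1 / 6)⁻¹ : ℝ) ^ numIterations n δ := by
    rw [← Real.rpow_natCast, ← Real.logb_le_iff_le_rpow (by norm_num) (by positivity)]
    exact Nat.le_ceil _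
  rw [show ((1 - 1 / 6)⁻¹ : ℝ) = (5 / 6)⁻¹ by norm_num, inv_pow, div_le_iff₀ hδ0] at h
  have hp : (0 : ℝ) < (5 / 6) ^ numIterations n δ := by positivity
  have := mul_le_mul_of_nonneg_left h hp.le
  rw [mul_inv_cancel_left₀ hp.ne'] at this
  linarith

theorem sampleFailure_pos {n δ : ℝ} (hn : 2 ≤ n) (hδ0 : 0 < δ) (hδ1 : δ ≤ 1) :
    0 < sampleFailure n δ := by
  have : (0 : ℝ) < numIterations n δ := by exact_mod_cast one_le_numIterations hn hδ0 hδ1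
  unfold sampleFailure
  positivity

theorem numIterations_mul_sampleFailure {n δ : ℝ} (hn : 2 ≤ n) (hδ0 : 0 < δ) (hδ1 : δ ≤ 1) :
    numIterations n δ * ((gridExponent n + 1) * sampleFailure n δ) = δ / 2 := by
  have : (0 : ℝ) < numIterations n δ := by exact_mod_cast one_le_numIterations hn hδ0 hδ1
  unfold sampleFailure
  field_simp

theorem sampleFailure_le_one {n δ : ℝ} (hn : 2 ≤ n) (hδ0 : 0 < δ) (hδ1 : δ ≤ 1) :
    sampleFailure n δ ≤ 1 := by
  have h1 : (1 : ℝ) ≤ numIterations n δ := by exact_mod_cast one_le_numIterations hn hδ0 hδ1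
  have h2 : (0 : ℝ) ≤ gridExponent n := by positivity
  refine div_le_one_of_le₀ ?_ (by positivity)
  nlinarith

section Greedy

variable {α : Type u} [DecidableEq α] [Fintype α] {f : Finset α → ℤ} {L : ℤ} {S : Finset α}
  {τ δ : ℝ}

theorem thresholdSamplingForCover_eq (L : ℤ) (S : Finset α) (τ δ : ℝ) :
    thresholdSamplingForCover L S τ (1 / 2) δ =
      thresholdLoop L τ (1 / 2) (1 / 6) (sampleFailure (Fintype.card α) δ)
        (gridExponent (Fintype.card α)) (numIterations (Fintype.card α) δ) S Finset.univ := by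
  unfold thresholdSamplingForCover sampleFailure numIterations gridExponent
  rw [show (1 / 2 / 3 : ℝ) = 1 / 6 by norm_num]

theorem expect_thresholdSampling_unresolved_le (hf : Monotone f) (hs : IsSubmodular f)
    (hn : (2 : ℝ) ≤ Fintype.card α) (hτ : 0 < τ) (hδ0 : 0 < δ) (hδ1 : δ ≤ 1) (S : Finset α) :
    expect f (fun S' => if unresolved f L τ S' = 0 then 0 else 1)
      (thresholdSamplingForCover L S τ (1 / 2) δ) ≤ ENNReal.ofReal δ := by
  rw [thresholdSamplingForCover_eq]
  refine (expect_thresholdLoop_unresolved_le hf hs hτ (le_pow_gridExponent (by linarith))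
    (sampleFailure_pos hn hδ0 hδ1) (sampleFailure_le_one hn hδ0 hδ1) _ S
    (Finset.subset_univ _)).trans (ENNReal.ofReal_le_ofReal ?_)
  rw [numIterations_mul_sampleFailure hn hδ0 hδ1]
  have h1 : (unresolved f L τ S : ℝ) ≤ Fintype.card α := by
    exact_mod_cast unresolved_le_card.trans (Finset.card_le_univ _)
  have h2 := pow_numIterations_mul_le (n := Fintype.card α) (by linarith) hδ0
  have h3 := mul_le_mul_of_nonneg_left h1
    (by positivity : (0 : ℝ) ≤ (5 / 6) ^ numIterations (Fintype.card α) δ)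
  linarith

theorem expect_thresholdSampling_card_le (hf : Monotone f) (hs : IsSubmodular f)
    (hn : (2 : ℝ) ≤ Fintype.card α) (hτ : 0 < τ) (hδ0 : 0 < δ) (hδ1 : δ ≤ 1) {K : ℝ} (hK : 1 ≤ K)
    (hS : f S < L) (hgap : gap f L S ≤ 2 * τ * K ∨ gap f L S < τ) :
    expect f (fun S' => ENNReal.ofReal (S'.card + 14 * K * potential f L S'))
      (thresholdSamplingForCover L S τ (1 / 2) δ) ≤
      ENNReal.ofReal (S.card + 14 * K * potential f L S + Fintype.card α * (δ / 2)) := by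
  rw [thresholdSamplingForCover_eq]
  refine (expect_thresholdLoop_card_le hf hs hτ (le_pow_gridExponent (by linarith))
    (sampleFailure_pos hn hδ0 hδ1) (sampleFailure_le_one hn hδ0 hδ1) hK _ hS hgap
    (Finset.subset_univ _)).trans (le_of_eq ?_)
  rw [numIterations_mul_sampleFailure hn hδ0 hδ1]

/-! ### The outer loop -/

/-- Adding an optimal cover to `S` closes the gap, and by submodularity its gain is at most the sum
of `optCoverSize f L` single gains. -/
theorem gap_le_optCoverSize_mul (hf : Monotone f) (hs : IsSubmodular f)
    (hL : L ≤ f Finset.univ) {c : ℝ} (h : ∀ x, ((marginalGain f {x} S : ℤ) : ℝ) ≤ c) :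
    gap f L S ≤ optCoverSize f L * c := by
  obtain ⟨O, hO, hLO⟩ := exists_optimal_cover hL
  have h1 : L - f S ≤ marginalGain f O S := by
    have := hf (Finset.subset_union_right (s₁ := S) (s₂ := O))
    unfold marginalGain
    omega
  have h2 := h1.trans (marginalGain_le_sum hf hs S O)
  calc gap f L S ≤ ((∑ x ∈ O, marginalGain f {x} S : ℤ) : ℝ) := Int.cast_le.2 h2
    _ = ∑ x ∈ O, ((marginalGain f {x} S : ℤ) : ℝ) := by push_cast; rfl
    _ ≤ O.card • c := Finset.sum_le_card_nsmul _ _ _ fun x _ => h x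
    _ = _ := by rw [nsmul_eq_mul, hO]

theorem marginalGain_lt_or_of_unresolved (h : unresolved f L τ S = 0) :
    (∀ x, ((marginalGain f {x} S : ℤ) : ℝ) < τ) ∨ 2 * gap f L S < τ := by
  unfold unresolved at h
  split_ifs at h with hg
  · exact Or.inr hg
  · left
    intro x
    by_contra hx
    rw [Finset.card_eq_zero] at h
    have : x ∈ survivors f τ S := by simpa [survivors] using hx
    rw [h] at this
    simp at this

/-- Integrality: gains below 1 are at most 0, and a gap below 1/2 is not positive. -/
theorem le_of_unresolved (hf : Monotone f) (hs : IsSubmodular f)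
    (hL : L ≤ f Finset.univ) (hτ : τ ≤ 1) (h : unresolved f L τ S = 0) : L ≤ f S := by
  rcases marginalGain_lt_or_of_unresolved h with h | h
  · rw [← gap_nonpos_iff]
    refine (gap_le_optCoverSize_mul hf hs hL (c := 0) fun x => ?_).trans (by simp)
    have := (h x).trans_le hτ
    have : marginalGain f {x} S < 1 := by exact_mod_cast this
    exact_mod_cast (by omega)
  · by_contra hS
    have := one_le_gap (not_le.1 hS)
    linarith

theorem expect_greedyLoop_succ (f : Finset α → ℤ) (φ : Finset α → ℝ≥0∞) (L : ℤ) (δ : ℝ) (j : ℕ)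
    (τ : ℝ) (S : Finset α) :
    expect f φ (greedyLoop L (1 / 2) δ (j + 1) τ S) =
      expect f (fun S' => if L ≤ f S' then φ S' else
        expect f φ (greedyLoop L (1 / 2) δ j ((1 - 1 / 2) * τ) S'))
        (thresholdSamplingForCover L S τ (1 / 2) δ) := by
  rw [greedyLoop, expect_bind]
  congr 1
  funext S'
  simp only [expect, Finset.mem_singleton_self, if_true]
  split_ifs <;> rfl

/-- Only the call at the last threshold, at most 1, can cause failure, so no union bound over the
calls is needed. -/
theorem expect_greedyLoop_fails_le (hf : Monotone f) (hs : IsSubmodular f)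
    (hn : (2 : ℝ) ≤ Fintype.card α) (hL : L ≤ f Finset.univ) (hδ0 : 0 < δ) (hδ1 : δ ≤ 1) (j : ℕ)
    (hτ : 0 < τ) (hτj : τ * (1 / 2) ^ j ≤ 1) (S : Finset α) :
    expect f (fun S' => if L ≤ f S' then 0 else 1) (greedyLoop L (1 / 2) δ (j + 1) τ S) ≤
      ENNReal.ofReal δ := by
  induction j generalizing τ S with
  | zero =>
    rw [expect_greedyLoop_succ]
    refine (expect_mono (fun S' => ?_) _).trans
      (expect_thresholdSampling_unresolved_le (L := L) hf hs hn hτ hδ0 hδ1 S)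
    by_cases h : unresolved f L τ S' = 0
    · simp [le_of_unresolved hf hs hL (by simpa using hτj) h]
    · rw [if_neg h]
      simp only [greedyLoop, expect]
      split_ifs <;> simp
  | succ j ih =>
    rw [expect_greedyLoop_succ]
    refine expect_le_const (fun S' => ?_) _
    split_ifs with h
    · exact zero_le
    · refine ih (by linarith) ?_ S'
      rw [pow_succ] at hτj
      linarith

/-- The hypothesis `hgap` is the invariant of the outer loop. After a successful call at `τ` either
all gains are below `τ`, so the gap is at most `K * τ = 2 * (τ / 2) * K`, or the gap is below `τ /
2`; both restore it for the threshold `τ / 2`. -/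
theorem expect_greedyLoop_card_le (hf : Monotone f) (hs : IsSubmodular f)
    (hn : (2 : ℝ) ≤ Fintype.card α) (hL : L ≤ f Finset.univ) (h0 : f ∅ < L) (hδ0 : 0 < δ)
    (hδ1 : δ ≤ 1) (j : ℕ) (hτ : 0 < τ) {S : Finset α} (hS : f S < L)
    (hgap : gap f L S ≤ 2 * τ * optCoverSize f L ∨ gap f L S < τ) :
    expect f (fun S' => (S'.card : ℝ≥0∞)) (greedyLoop L (1 / 2) δ j τ S) ≤
      ENNReal.ofReal (S.card + 14 * optCoverSize f L * potential f L S +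
        Fintype.card α * (j * (3 / 2 * δ))) := by
  have hK : (1 : ℝ) ≤ optCoverSize f L := by exact_mod_cast one_le_optCoverSize hL h0
  set K : ℝ := (optCoverSize f L : ℝ) with hKdef
  set n : ℝ := (Fintype.card α : ℝ) with hndef
  have hn0 : 0 ≤ n := by linarith
  have hsum : ∀ S' : Finset α, 0 ≤ 14 * K * potential f L S' := fun S' =>
    mul_nonneg (by linarith) potential_nonneg
  induction j generalizing τ S with
  | zero =>
    simp only [greedyLoop, expect]
    rw [← ENNReal.ofReal_natCast]
    refine ENNReal.ofReal_le_ofReal ?_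
    have := hsum S
    simpa using this
  | succ j ih =>
    have hjδ : 0 ≤ n * (j * (3 / 2 * δ)) := by positivity
    rw [expect_greedyLoop_succ]
    have hinner : ∀ S' : Finset α, (if L ≤ f S' then (S'.card : ℝ≥0∞) else
        expect f (fun S' => (S'.card : ℝ≥0∞)) (greedyLoop L (1 / 2) δ j ((1 - 1 / 2) * τ) S')) ≤
        ENNReal.ofReal (S'.card + 14 * K * potential f L S') +
          ENNReal.ofReal (n * (j * (3 / 2 * δ))) +
          ENNReal.ofReal n * (if unresolved f L τ S' = 0 then 0 else 1) := by
      intro S'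
      split_ifs with h h' h'
      · refine le_add_right (le_add_right ?_)
        rw [← ENNReal.ofReal_natCast]
        exact ENNReal.ofReal_le_ofReal (by linarith [hsum S'])
      · refine le_add_right (le_add_right ?_)
        rw [← ENNReal.ofReal_natCast]
        exact ENNReal.ofReal_le_ofReal (by linarith [hsum S'])
      · rw [mul_zero, add_zero, ← ENNReal.ofReal_add (add_nonneg (by positivity) (hsum S')) hjδ]
        refine ih (by linarith) (not_le.1 h) ?_
        rcases marginalGain_lt_or_of_unresolved h' with h' | h'
        · left
          have := gap_le_optCoverSize_mul hf hs hL fun x => (h' x).le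
          linarith
        · right
          linarith
      · rw [mul_one]
        refine le_add_left (expect_le_const (fun S'' => ?_) _)
        rw [← ENNReal.ofReal_natCast]
        exact ENNReal.ofReal_le_ofReal (Nat.cast_le.2 (Finset.card_le_univ _))
    refine (expect_mono hinner _).trans ?_
    rw [expect_add, expect_add, expect_const, expect_const_mul]
    -- Each threshold costs `n * (δ / 2)` for bad sample sizes and `n * δ` for ending unresolved,
    -- where the final size is bounded by `n`; together `n * (3 / 2 * δ)`.
    calc _ ≤ ENNReal.ofReal (S.card + 14 * K * potential f L S + n * (δ / 2)) +
          ENNReal.ofReal (n * (j * (3 / 2 * δ))) + ENNReal.ofReal n * ENNReal.ofReal δ := by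
          gcongr
          · exact expect_thresholdSampling_card_le hf hs hn hτ hδ0 hδ1 hK hS hgap
          · exact expect_thresholdSampling_unresolved_le hf hs hn hτ hδ0 hδ1 S
      _ = _ := by
          have h1 := hsum S
          rw [← ENNReal.ofReal_mul hn0, ← ENNReal.ofReal_add (by positivity) hjδ,
            ← ENNReal.ofReal_add (by positivity) (by positivity)]
          congr 1
          push_cast
          ring

theorem costAtMost_greedyLoop (f : Finset α → ℤ) (L : ℤ) (δ : ℝ) {q : ℕ}
    (hq : Fintype.card α + 1 ≤ q)
    (hq' : 2 * ((gridExponent (Fintype.card α) + 1) *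
      numSamples (1 / 6) (sampleFailure (Fintype.card α) δ)) ≤ q) (j : ℕ) (τ : ℝ)
    (S : Finset α) :
    CostAtMost f (j * (3 * numIterations (Fintype.card α) δ + 1)) q
      (greedyLoop L (1 / 2) δ j τ S) := by
  induction j generalizing τ S with
  | zero => exact costAtMost_ret _ _ _ _
  | succ j ih =>
    rw [greedyLoop, thresholdSamplingForCover_eq]
    have h := (costAtMost_thresholdLoop f L τ (1 / 2) (1 / 6)
      (sampleFailure (Fintype.card α) δ) (gridExponent (Fintype.card α)) hq hq'
      (numIterations (Fintype.card α) δ) S (A := Finset.univ) Finset.card_univ.le).bind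
      (R' := j * (3 * numIterations (Fintype.card α) δ + 1) + 1)
      (g := fun S' => .query {S'} fun v => if L ≤ v S' then .ret S' else
        greedyLoop L (1 / 2) δ j ((1 - 1 / 2) * τ) S') fun S' => by
        refine costAtMost_query (by rw [Finset.card_singleton]; omega) ?_
        dsimp only
        split_ifs
        · exact costAtMost_ret _ _ _ _
        · exact ih _ _
        · exact costAtMost_ret _ _ _ _
        · exact ih _ _
    refine h.mono (le_of_eq ?_)
    ring

end Greedy

end SubmodularCover

namespace SubmodularCover

open AdaptiveAlg

/-! ### Adaptive-Greedy-Cover -/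

section Main

variable {α : Type u} [DecidableEq α] [Fintype α] {f : Finset α → ℤ} {L : ℤ}

theorem exists_bestSingleton_eq [Nonempty α] (v : Finset α → ℤ) :
    ∃ x, bestSingleton v = {x} ∧ ∀ y, v {y} ≤ v {x} := by
  have h : Nonempty α := inferInstance
  refine ⟨(@Finite.exists_max α ℤ _ h _ fun x => v {x}).choose, ?_,
    (@Finite.exists_max α ℤ _ h _ fun x => v {x}).choose_spec⟩
  unfold bestSingleton
  rw [dif_pos h]

/-- The number of thresholds after the first one. -/
noncomputable def numThresholds (Δ : ℝ) : ℕ := ⌈Real.log Δ / (1 / 2)⌉₊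

/-- The failure probability passed to Threshold-Sampling-For-Cover. -/
noncomputable def greedyFailure (n Δ : ℝ) : ℝ := 1 / (n * (numThresholds Δ + 1))

/-- The values that the initial round reveals. -/
noncomputable def singletonOracle (f : Finset α → ℤ) : Finset α → ℤ := fun S =>
  if S ∈ Finset.univ.image fun x : α => ({x} : Finset α) then f S else 0

theorem singletonOracle_singleton (f : Finset α → ℤ) (x : α) : singletonOracle f {x} = f {x} :=
  if_pos (Finset.mem_image_of_mem _ (Finset.mem_univ x))

theorem exists_expect_adaptiveGreedyCover [Nonempty α] (f : Finset α → ℤ) (L : ℤ) :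
    ∃ x : α, (∀ y, f {y} ≤ f {x}) ∧
      (∀ φ : Finset α → ℝ≥0∞, expect f φ (adaptiveGreedyCover α L) = if L ≤ f {x} then φ {x} else
        expect f φ (greedyLoop L (1 / 2) (greedyFailure (Fintype.card α) (f {x}))
          (numThresholds (f {x}) + 1) (f {x}) ∅)) ∧
      ∀ R q : ℕ, Fintype.card α ≤ q → (¬ L ≤ f {x} →
        CostAtMost f R q (greedyLoop L (1 / 2) (greedyFailure (Fintype.card α) (f {x}))
          (numThresholds (f {x}) + 1) (f {x}) ∅)) →
        CostAtMost f (R + 1) q (adaptiveGreedyCover α L) := by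
  obtain ⟨x, hx, hmax⟩ := exists_bestSingleton_eq (singletonOracle f)
  simp only [singletonOracle_singleton] at hmax
  refine ⟨x, hmax, fun φ => ?_, fun R q hq h => ?_⟩
  · change expect f φ (if L ≤ singletonOracle f (bestSingleton (singletonOracle f)) then
      .ret (bestSingleton (singletonOracle f)) else
      greedyLoop L (1 / 2) (greedyFailure (Fintype.card α)
        ((singletonOracle f (bestSingleton (singletonOracle f)) : ℤ) : ℝ))
        (numThresholds ((singletonOracle f (bestSingleton (singletonOracle f)) : ℤ) : ℝ) + 1)
        ((singletonOracle f (bestSingleton (singletonOracle f)) : ℤ) : ℝ) ∅) = _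
    simp only [hx, singletonOracle_singleton]
    split_ifs <;> rfl
  · refine costAtMost_query (Finset.card_image_le.trans (by rwa [Finset.card_univ])) ?_
    change CostAtMost f R q (if L ≤ singletonOracle f (bestSingleton (singletonOracle f)) then
      .ret (bestSingleton (singletonOracle f)) else
      greedyLoop L (1 / 2) (greedyFailure (Fintype.card α)
        ((singletonOracle f (bestSingleton (singletonOracle f)) : ℤ) : ℝ))
        (numThresholds ((singletonOracle f (bestSingleton (singletonOracle f)) : ℤ) : ℝ) + 1)
        ((singletonOracle f (bestSingleton (singletonOracle f)) : ℤ) : ℝ) ∅)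
    simp only [hx, singletonOracle_singleton]
    split_ifs with hL
    · exact costAtMost_ret _ _ _ _
    · exact h hL

theorem greedyFailure_pos {n Δ : ℝ} (hn : 0 < n) : 0 < greedyFailure n Δ := by
  unfold greedyFailure; positivity

theorem greedyFailure_le {n Δ : ℝ} (hn : 0 < n) : greedyFailure n Δ ≤ 1 / n := by
  unfold greedyFailure
  refine one_div_le_one_div_of_le hn (le_mul_of_one_le_right hn.le ?_)
  linarith [(numThresholds Δ).cast_nonneg (α := ℝ)]

theorem mul_greedyFailure {n Δ : ℝ} (hn : 0 < n) :
    n * ((numThresholds Δ + 1 : ℕ) * greedyFailure n Δ) = 1 := by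
  have : (0 : ℝ) < (numThresholds Δ : ℝ) + 1 := by positivity
  unfold greedyFailure
  push_cast
  field_simp

/-- There are at least `2 * log Δ` halvings, and `2 * log 2 > 1`. -/
theorem mul_half_pow_numThresholds_le {Δ : ℝ} (h : 1 ≤ Δ) :
    Δ * (1 / 2) ^ numThresholds Δ ≤ 1 := by
  have h0 : 0 < Δ := by linarith
  have hlog := Real.log_nonneg h
  have h1 := Nat.le_ceil (Real.log Δ / (1 / 2))
  have h2 := Real.log_two_gt_d9
  rw [← Real.log_nonpos_iff (by positivity), Real.log_mul h0.ne' (by positivity), Real.log_pow,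
    one_div, Real.log_inv]
  unfold numThresholds
  nlinarith

/-- If no singleton had positive value, the whole ground set would gain nothing over `∅`,
contradicting `f ∅ < L ≤ f univ`. -/
theorem one_le_of_forall_singleton_le (hf0 : ∀ S, 0 ≤ f S) (hf : Monotone f)
    (hs : IsSubmodular f) (h0 : f ∅ < L) (hL : L ≤ f Finset.univ) {x : α}
    (hx : ∀ y, f {y} ≤ f {x}) : 1 ≤ f {x} := by
  by_contra h
  have h1 : marginalGain f Finset.univ ∅ ≤ 0 :=
    (marginalGain_le_sum hf hs ∅ Finset.univ).trans (Finset.sum_nonpos fun y _ => by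
      have := hx y
      have := hf0 ∅
      rw [marginalGain, Finset.empty_union]
      omega)
  rw [marginalGain, Finset.empty_union] at h1
  omega

theorem two_thirds_le_log {L : ℤ} (hL : 2 ≤ L) : 2 / 3 ≤ Real.log L := by
  have h1 := Real.log_two_gt_d9
  have h2 : Real.log 2 ≤ Real.log L := Real.log_le_log (by norm_num) (by exact_mod_cast hL)
  linarith

theorem expect_adaptiveGreedyCover_fails_le (hf0 : ∀ S, 0 ≤ f S) (hf : Monotone f)
    (hs : IsSubmodular f) (hn : 2 ≤ Fintype.card α) (h0 : f ∅ < L) (hL : L ≤ f Finset.univ) :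
    expect f (fun S => if L ≤ f S then 0 else 1) (adaptiveGreedyCover α L) ≤
      ENNReal.ofReal (1 / Fintype.card α) := by
  have : Nonempty α := Fintype.card_pos_iff.1 (by omega)
  have hn' : (2 : ℝ) ≤ Fintype.card α := by exact_mod_cast hn
  have hn0 : (0 : ℝ) < Fintype.card α := by linarith
  obtain ⟨x, hx, hexp, -⟩ := exists_expect_adaptiveGreedyCover f L
  have h1 : (1 : ℝ) ≤ f {x} := by exact_mod_cast one_le_of_forall_singleton_le hf0 hf hs h0 hL hx
  rw [hexp]
  split_ifs
  · exact zero_le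
  · have hle := greedyFailure_le (Δ := f {x}) hn0
    refine (expect_greedyLoop_fails_le hf hs hn' hL (greedyFailure_pos hn0)
      (hle.trans ((div_le_one hn0).2 (by linarith))) _ (by linarith)
      (mul_half_pow_numThresholds_le h1) ∅).trans (ENNReal.ofReal_le_ofReal hle)

theorem expect_adaptiveGreedyCover_card_le (hf0 : ∀ S, 0 ≤ f S) (hf : Monotone f)
    (hs : IsSubmodular f) (hn : 2 ≤ Fintype.card α) (hL2 : 2 ≤ L) (h0 : f ∅ < L)
    (hL : L ≤ f Finset.univ) :
    expect f (fun S => (S.card : ℝ≥0∞)) (adaptiveGreedyCover α L) ≤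
      ENNReal.ofReal (38 * (optCoverSize f L * Real.log L)) := by
  have : Nonempty α := Fintype.card_pos_iff.1 (by omega)
  have hn' : (2 : ℝ) ≤ Fintype.card α := by exact_mod_cast hn
  have hn0 : (0 : ℝ) < Fintype.card α := by linarith
  have hK : (1 : ℝ) ≤ optCoverSize f L := by exact_mod_cast one_le_optCoverSize hL h0
  have hlog := two_thirds_le_log hL2
  obtain ⟨x, hx, hexp, -⟩ := exists_expect_adaptiveGreedyCover f L
  have h1 : (1 : ℝ) ≤ f {x} := by exact_mod_cast one_le_of_forall_singleton_le hf0 hf hs h0 hL hx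
  have hKlog : (optCoverSize f L : ℝ) * (2 / 3) ≤ optCoverSize f L * Real.log L := by gcongr
  rw [hexp]
  split_ifs
  · rw [Finset.card_singleton, Nat.cast_one, ← ENNReal.ofReal_one]
    exact ENNReal.ofReal_le_ofReal (by linarith)
  · have hle := greedyFailure_le (Δ := f {x}) hn0
    have hgap : gap f L ∅ ≤ optCoverSize f L * f {x} :=
      gap_le_optCoverSize_mul hf hs hL fun y => by
        have h2 := hx y
        have h3 := hf0 ∅
        rw [marginalGain, Finset.empty_union]
        exact_mod_cast (by omega)
    refine (expect_greedyLoop_card_le hf hs hn' hL h0 (greedyFailure_pos hn0)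
      (hle.trans ((div_le_one hn0).2 (by linarith))) _ (by linarith) h0
      (Or.inl (hgap.trans (by nlinarith)))).trans (ENNReal.ofReal_le_ofReal ?_)
    have h2 := mul_greedyFailure (Δ := f {x}) hn0
    -- Since `log L ≥ 2 / 3`, the potential part is at most `14 * 5 / 2 = 35` units of `k* log L`,
    -- and the error term `3 / 2` is at most `9 / 4` units; hence 38.
    have h3 : potential f L ∅ ≤ 5 / 2 * Real.log L := by
      rw [potential, if_neg (not_le.2 h0)]
      have : Real.log (gap f L ∅) ≤ Real.log L := by
        refine Real.log_le_log (by linarith [one_le_gap h0]) ?_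
        have := hf0 ∅
        unfold gap
        exact_mod_cast (by omega)
      linarith
    have h4 : (optCoverSize f L : ℝ) * potential f L ∅ ≤
        optCoverSize f L * (5 / 2 * Real.log L) := by gcongr
    rw [Finset.card_empty, Nat.cast_zero]
    linarith

theorem expect_completedGreedyCover (f : Finset α → ℤ) (L : ℤ) (φ : Finset α → ℝ≥0∞) :
    expect f φ (completedGreedyCover α L) =
      expect f (fun S => if L ≤ f S then φ S else φ Finset.univ) (adaptiveGreedyCover α L) := by
  rw [completedGreedyCover, expect_bind]
  congr 1
  funext S
  simp only [expect, Finset.mem_singleton_self, if_true]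
  split_ifs <;> rfl

theorem le_of_mem_support_completedGreedyCover (hL : L ≤ f Finset.univ)
    {o : Finset α × List ℕ} (ho : o ∈ (run f (completedGreedyCover α L)).support) :
    L ≤ f o.1 := by
  obtain ⟨o₁, -, o₂, h₂, h, -⟩ := exists_of_mem_support_run_bind ho
  rw [h]
  simp only [run, Finset.mem_singleton_self, if_true, PMF.mem_support_map_iff] at h₂
  obtain ⟨o', h', rfl⟩ := h₂
  split_ifs at h' with hS
  · simp only [run, PMF.support_pure, Set.mem_singleton_iff] at h'
    simpa [h'] using hS
  · simp only [run, PMF.support_pure, Set.mem_singleton_iff] at h'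
    simpa [h'] using hL

theorem expect_completedGreedyCover_card_le (hf0 : ∀ S, 0 ≤ f S) (hf : Monotone f)
    (hs : IsSubmodular f) (hn : 2 ≤ Fintype.card α) (hL2 : 2 ≤ L) (h0 : f ∅ < L)
    (hL : L ≤ f Finset.univ) :
    expect f (fun S => (S.card : ℝ≥0∞)) (completedGreedyCover α L) ≤
      ENNReal.ofReal (40 * (optCoverSize f L * Real.log L)) := by
  have hK : (1 : ℝ) ≤ optCoverSize f L := by exact_mod_cast one_le_optCoverSize hL h0
  have hlog := two_thirds_le_log hL2
  have hKlog : (optCoverSize f L : ℝ) * (2 / 3) ≤ optCoverSize f L * Real.log L := by gcongr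
  have hn0 : (0 : ℝ) < Fintype.card α := by exact_mod_cast (by omega : 0 < Fintype.card α)
  rw [expect_completedGreedyCover]
  calc _ ≤ expect f (fun S => (S.card : ℝ≥0∞) +
        ENNReal.ofReal (Fintype.card α) * (if L ≤ f S then 0 else 1)) (adaptiveGreedyCover α L) := by
        refine expect_mono (fun S => ?_) _
        split_ifs
        · simp
        · rw [mul_one, ENNReal.ofReal_natCast, Finset.card_univ]
          exact le_add_self
    -- Returning the whole ground set costs `n` with probability at most `1 / n`, so 1 in
    -- expectation, which two further units of `k* log L` absorb.
    _ ≤ ENNReal.ofReal (38 * (optCoverSize f L * Real.log L)) +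
          ENNReal.ofReal (Fintype.card α) * ENNReal.ofReal (1 / Fintype.card α) := by
        rw [expect_add, expect_const_mul]
        gcongr
        · exact expect_adaptiveGreedyCover_card_le hf0 hf hs hn hL2 h0 hL
        · exact expect_adaptiveGreedyCover_fails_le hf0 hf hs hn h0 hL
    _ ≤ _ := by
        rw [← ENNReal.ofReal_mul hn0.le, mul_one_div_cancel hn0.ne',
          ← ENNReal.ofReal_add (by linarith) zero_le_one]
        exact ENNReal.ofReal_le_ofReal (by linarith)

/-! ### Bounds for the number of rounds and queries -/

/-- From `log b ≥ 1 - b⁻¹`; it is applied with base 6/5 and `c = 6`, and with base 7/6 and `c = 7`.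
-/
theorem logb_le_mul_log {b c x : ℝ} (hc : 0 < c) (hb : 1 < b) (h : 1 - b⁻¹ = c⁻¹) (hx : 1 ≤ x) :
    Real.logb b x ≤ c * Real.log x := by
  have h1 := Real.one_sub_inv_le_log_of_pos (by linarith : 0 < b)
  rw [h] at h1
  rw [Real.logb, div_le_iff₀ (Real.log_pos hb)]
  have h2 := Real.log_nonneg hx
  have h3 := mul_le_mul_of_nonneg_left h1 (mul_nonneg hc.le h2)
  rwa [mul_right_comm, mul_inv_cancel₀ hc.ne', one_mul] at h3

section Bounds

variable {n l Δ : ℝ}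

/-- Here `l` stands for `log L`. Keeping `n * l` away from 1 makes `log (n * l)` at least 1/4, so
additive constants can be absorbed into the main terms. -/
theorem four_thirds_le_mul (hn : 2 ≤ n) (hl : 2 / 3 ≤ l) : 4 / 3 ≤ n * l := by nlinarith

theorem quarter_le_log {y : ℝ} (hy : 4 / 3 ≤ y) : 1 / 4 ≤ Real.log y := by
  have h0 : 0 < y := by linarith
  have h1 := Real.one_sub_inv_le_log_of_pos h0
  have h2 : y⁻¹ ≤ (4 / 3)⁻¹ := inv_anti₀ (by norm_num) hy
  norm_num at h2
  linarith

theorem numThresholds_add_one_le (hl : 2 / 3 ≤ l) (hΔ : 1 ≤ Δ) (hΔl : Real.log Δ ≤ l) :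
    (numThresholds Δ : ℝ) + 1 ≤ 5 * l := by
  have h0 := Real.log_nonneg hΔ
  have := Nat.ceil_lt_add_one (by linarith : 0 ≤ Real.log Δ / (1 / 2))
  unfold numThresholds
  linarith

theorem log_le_of_le_two_pow {c : ℝ} {k : ℕ} (hc : 0 < c) (h : c ≤ 2 ^ k) :
    Real.log c ≤ 7 / 10 * k := by
  have h1 := Real.log_le_log hc h
  rw [Real.log_pow] at h1
  have h2 := Real.log_two_lt_d9
  have : (0 : ℝ) ≤ k := by positivity
  nlinarith

theorem numIterations_le (hn : 2 ≤ n) (hl : 2 / 3 ≤ l) (hΔ : 1 ≤ Δ) (hΔl : Real.log Δ ≤ l) :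
    (numIterations n (greedyFailure n Δ) : ℝ) ≤ 88 * Real.log (n * l) := by
  have hy := four_thirds_le_mul hn hl
  have hlogy := quarter_le_log hy
  have hm := numThresholds_add_one_le hl hΔ hΔl
  have hm0 : (0 : ℝ) ≤ numThresholds Δ := by positivity
  have e : 2 * n / greedyFailure n Δ = 2 * n * (n * (numThresholds Δ + 1)) := by
    unfold greedyFailure; rw [div_div_eq_mul_div, div_one]
  have hx1 : 1 ≤ 2 * n / greedyFailure n Δ := by
    have : 1 ≤ n * (numThresholds Δ + 1) := by nlinarith
    rw [e]
    nlinarith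
  have hx2 : 2 * n / greedyFailure n Δ ≤ 15 * (n * l) ^ 2 := by
    rw [e]
    have h1 : n * (numThresholds Δ + 1) ≤ 5 * (n * l) := by nlinarith
    have h2 : n ≤ 3 / 2 * (n * l) := by nlinarith
    nlinarith
  have h1 := Nat.ceil_lt_add_one (Real.logb_nonneg (by norm_num : (1 : ℝ) < (1 - 1 / 6)⁻¹) hx1)
  have h2 := logb_le_mul_log (b := (1 - 1 / 6)⁻¹) (c := 6) (by norm_num) (by norm_num)
    (by norm_num) hx1
  have h3 := Real.log_le_log (by linarith) hx2
  rw [Real.log_mul (by norm_num) (by positivity), Real.log_pow] at h3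
  have h4 := log_le_of_le_two_pow (c := 15) (k := 4) (by norm_num) (by norm_num)
  unfold numIterations
  push_cast at h3 h4
  linarith

theorem gridExponent_add_one_le (hn : 2 ≤ n) (hl : 2 / 3 ≤ l) :
    (gridExponent n : ℝ) + 1 ≤ 11 * (n * l) := by
  have h1 := Nat.ceil_lt_add_one
    (Real.logb_nonneg (by norm_num : (1 : ℝ) < 1 + 1 / 6) (by linarith : 1 ≤ n))
  have h2 := logb_le_mul_log (b := 1 + 1 / 6) (c := 7) (by norm_num) (by norm_num)
    (by norm_num) (by linarith : 1 ≤ n)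
  have h3 := Real.log_le_sub_one_of_pos (by linarith : 0 < n)
  unfold gridExponent
  nlinarith

theorem numSamples_le (hn : 2 ≤ n) (hl : 2 / 3 ≤ l) (hΔ : 1 ≤ Δ) (hΔl : Real.log Δ ≤ l) :
    (numSamples (1 / 6) (sampleFailure n (greedyFailure n Δ)) : ℝ) ≤ 8000 * (n * l) := by
  have hy := four_thirds_le_mul hn hl
  have hm := numThresholds_add_one_le hl hΔ hΔl
  have hm0 : (0 : ℝ) ≤ numThresholds Δ := by positivity
  have hg := gridExponent_add_one_le hn hl
  have hlogy := Real.log_le_sub_one_of_pos (by linarith : 0 < n * l)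
  have hr : (numIterations n (greedyFailure n Δ) : ℝ) ≤ 88 * (n * l) := by
    linarith [numIterations_le hn hl hΔ hΔl]
  have hδ1 : greedyFailure n Δ ≤ 1 :=
    (greedyFailure_le (by linarith)).trans ((div_le_one (by linarith)).2 (by linarith))
  have hδ0 : 0 < greedyFailure n Δ := greedyFailure_pos (by linarith)
  have hr1 : (1 : ℝ) ≤ numIterations n (greedyFailure n Δ) := by
    exact_mod_cast one_le_numIterations hn hδ0 hδ1
  have e : 2 / sampleFailure n (greedyFailure n Δ) =
      4 * (numIterations n (greedyFailure n Δ) * (gridExponent n + 1) *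
        (n * (numThresholds Δ + 1))) := by
    rw [sampleFailure]
    generalize (numIterations n (greedyFailure n Δ) : ℝ) = r
    rw [greedyFailure]
    rw [div_div_eq_mul_div, div_div_eq_mul_div]
    ring
  have hp : 0 < 2 / sampleFailure n (greedyFailure n Δ) :=
    div_pos two_pos (sampleFailure_pos hn hδ0 hδ1)
  -- `19360 = 4 * 88 * 11 * 5`, from the bounds for the iterations, the grid and the thresholds.
  have hle : 2 / sampleFailure n (greedyFailure n Δ) ≤ 19360 * (n * l) ^ 3 := by
    rw [e]
    have h1 : n * (numThresholds Δ + 1) ≤ 5 * (n * l) := by nlinarith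
    calc _ ≤ 4 * (88 * (n * l) * (11 * (n * l)) * (5 * (n * l))) := by gcongr
      _ = _ := by ring
  have h1 := Real.log_le_log hp hle
  rw [Real.log_mul (by norm_num) (by positivity), Real.log_pow] at h1
  have h2 := log_le_of_le_two_pow (c := 19360) (k := 15) (by norm_num) (by norm_num)
  push_cast at h1 h2
  have h3 : Real.log (2 / sampleFailure n (greedyFailure n Δ)) ≤ 11 * (n * l) := by linarith
  have h4 : 0 ≤ Real.log (2 / sampleFailure n (greedyFailure n Δ)) :=
    Real.log_nonneg (by
      rw [le_div_iff₀ (sampleFailure_pos hn hδ0 hδ1)]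
      linarith [sampleFailure_le_one hn hδ0 hδ1])
  have h5 := Nat.ceil_lt_add_one (div_nonneg h4 (by norm_num : (0 : ℝ) ≤ (1 / 6) ^ 2))
  unfold numSamples
  generalize Real.log (2 / sampleFailure n (greedyFailure n Δ)) = w at *
  rw [show w / (1 / 6) ^ 2 = 36 * w by ring] at *
  push_cast
  linarith

theorem rounds_le (hn : 2 ≤ n) (hl : 2 / 3 ≤ l) (hΔ : 1 ≤ Δ) (hΔl : Real.log Δ ≤ l) :
    ((numThresholds Δ + 1) * (3 * numIterations n (greedyFailure n Δ) + 1) + 1 + 1 : ℝ) ≤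
      200000 * (Real.log (n * l) * l) := by
  have hm := numThresholds_add_one_le hl hΔ hΔl
  have hr := numIterations_le hn hl hΔ hΔl
  have hlogy := quarter_le_log (four_thirds_le_mul hn hl)
  have h1 : (3 * numIterations n (greedyFailure n Δ) + 1 : ℝ) ≤ 268 * Real.log (n * l) := by
    linarith
  have h2 : ((numThresholds Δ + 1) * (3 * numIterations n (greedyFailure n Δ) + 1) : ℝ) ≤
      5 * l * (268 * Real.log (n * l)) := by gcongr
  have h3 : 1 / 6 ≤ Real.log (n * l) * l := by nlinarith
  linarith

theorem queries_le (hn : 2 ≤ n) (hl : 2 / 3 ≤ l) (hΔ : 1 ≤ Δ) (hΔl : Real.log Δ ≤ l) :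
    n + 1 + 2 * ((gridExponent n + 1) *
      numSamples (1 / 6) (sampleFailure n (greedyFailure n Δ))) ≤ 200000 * (n * l) ^ 2 := by
  have hy := four_thirds_le_mul hn hl
  have h1 : ((gridExponent n + 1) *
      numSamples (1 / 6) (sampleFailure n (greedyFailure n Δ)) : ℝ) ≤
      11 * (n * l) * (8000 * (n * l)) := by
    gcongr
    · exact gridExponent_add_one_le hn hl
    · exact numSamples_le hn hl hΔ hΔl
  have h2 : n + 1 ≤ 9 / 4 * (n * l) := by nlinarith
  nlinarith

end Bounds

theorem exists_costAtMost (hf0 : ∀ S, 0 ≤ f S) (hf : Monotone f) (hs : IsSubmodular f)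
    (hn : 2 ≤ Fintype.card α) (hL2 : 2 ≤ L) (h0 : f ∅ < L) (hL : L ≤ f Finset.univ) :
    ∃ R q : ℕ, CostAtMost f R q (adaptiveGreedyCover α L) ∧
      CostAtMost f (R + 1) q (completedGreedyCover α L) ∧
      (R + 1 : ℝ) ≤ 200000 * (Real.log (Fintype.card α * Real.log L) * Real.log L) ∧
      (q : ℝ) ≤ 200000 * (Fintype.card α * Real.log L) ^ 2 := by
  have : Nonempty α := Fintype.card_pos_iff.1 (by omega)
  have hn' : (2 : ℝ) ≤ Fintype.card α := by exact_mod_cast hn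
  have hlog := two_thirds_le_log hL2
  obtain ⟨x, hx, -, hcost⟩ := exists_expect_adaptiveGreedyCover f L
  -- If `f {x} ≥ L` the program stops after one round, but `R` and `q` must be named in either case;
  -- truncating at `L` keeps `log Δ ≤ log L` and changes nothing when the loop runs.
  set Δ : ℝ := min (f {x} : ℝ) L with hΔdef
  have h1 : (1 : ℝ) ≤ f {x} := by exact_mod_cast one_le_of_forall_singleton_le hf0 hf hs h0 hL hx
  have hLpos : (2 : ℝ) ≤ L := by exact_mod_cast hL2
  have hΔ1 : 1 ≤ Δ := le_min h1 (by linarith)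
  have hΔl : Real.log Δ ≤ Real.log L := Real.log_le_log (by linarith) (min_le_right _ _)
  set δ := greedyFailure (Fintype.card α) Δ with hδ
  set q : ℕ := Fintype.card α + 1 + 2 * ((gridExponent (Fintype.card α) + 1) *
    numSamples (1 / 6) (sampleFailure (Fintype.card α) δ)) with hq
  have hadapt : CostAtMost f
      ((numThresholds Δ + 1) * (3 * numIterations (Fintype.card α) δ + 1) + 1) q
      (adaptiveGreedyCover α L) := by
    refine hcost _ q (by omega) fun hxL => ?_
    have hΔx : (f {x} : ℝ) = Δ :=
      (min_eq_left (by exact_mod_cast (not_le.1 hxL).le)).symm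
    rw [hΔx]
    exact costAtMost_greedyLoop f L _ (by omega) (by omega) _ _ _
  refine ⟨_, q, hadapt, ?_, ?_, ?_⟩
  · refine hadapt.bind (R' := 1) fun S => costAtMost_query (by rw [Finset.card_singleton]; omega) ?_
    dsimp only
    split_ifs <;> exact costAtMost_ret _ _ _ _
  · have := rounds_le hn' hlog hΔ1 hΔl
    push_cast
    exact this
  · have := queries_le hn' hlog hΔ1 hΔl
    rw [hq]
    push_cast
    exact this

end Main

end SubmodularCover

theorem mainTheorem7 :
    ∃ C : ℝ, 0 < C ∧
      ∀ (α : Type u) [Fintype α] [DecidableEq α] (f : Finset α → ℤ) (L : ℤ),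
        (∀ S, 0 ≤ f S) → Monotone f → IsSubmodular f →
        2 ≤ Fintype.card α → 2 ≤ L → f ∅ < L → L ≤ f Finset.univ →
        -- Adaptive-Greedy-Cover
        ((SubmodularCover.adaptiveGreedyCover α L).RunsWithin f
            (C * (Real.log (Fintype.card α * Real.log L) * Real.log L))
            (C * (Fintype.card α * Real.log L) ^ 2) ∧
          1 - 1 / (Fintype.card α : ℝ) ≤
            (SubmodularCover.adaptiveGreedyCover α L).coverProb f L ∧
          (SubmodularCover.adaptiveGreedyCover α L).expectedSize f ≤
            C * (optCoverSize f L * Real.log L)) ∧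
        -- its completion, which reaches the target on every outcome
        ((SubmodularCover.completedGreedyCover α L).RunsWithin f
            (C * (Real.log (Fintype.card α * Real.log L) * Real.log L))
            (C * (Fintype.card α * Real.log L) ^ 2) ∧
          (∀ o ∈ ((SubmodularCover.completedGreedyCover α L).run f).support, L ≤ f o.1) ∧
          (SubmodularCover.completedGreedyCover α L).expectedSize f ≤
            C * (optCoverSize f L * Real.log L)) := by
  -- The query bound dictates the size of this constant; the size bounds need only 38 and 40.
  refine ⟨200000, by norm_num, ?_⟩
  intro α _ _ f L hf0 hf hs hn hL2 h0 hL
  obtain ⟨R, q, hcost, hcost', hR, hq⟩ :=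
    SubmodularCover.exists_costAtMost hf0 hf hs hn hL2 h0 hL
  have hlog := SubmodularCover.two_thirds_le_log hL2
  have hKlog : 0 ≤ optCoverSize f L * Real.log L := mul_nonneg (by positivity) (by linarith)
  refine ⟨⟨hcost.runsWithin (by linarith) hq, ?_, ?_⟩, hcost'.runsWithin (by push_cast; linarith) hq,
    fun o ho => SubmodularCover.le_of_mem_support_completedGreedyCover hL ho, ?_⟩
  · exact AdaptiveAlg.le_coverProb (by positivity)
      (SubmodularCover.expect_adaptiveGreedyCover_fails_le hf0 hf hs hn h0 hL)
  · refine AdaptiveAlg.expectedSize_le (by linarith)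
      ((SubmodularCover.expect_adaptiveGreedyCover_card_le hf0 hf hs hn hL2 h0 hL).trans
        (ENNReal.ofReal_le_ofReal (by linarith)))
  · refine AdaptiveAlg.expectedSize_le (by linarith)
      ((SubmodularCover.expect_completedGreedyCover_card_le hf0 hf hs hn hL2 h0 hL).trans
        (ENNReal.ofReal_le_ofReal (by linarith)))
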